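/- **Setting.** An extended IFS $(X,D)$ consists of a non-empty Hausdorff space $X$ and a finite set $D$ of continuous maps $d\colon X^{\mathrm{ar}(d)}\to X$ of positive arity. It is a *digit space* if $X$ is a compact metric space with metric $\rho$, the sets $\mathrm{range}(d)$, $d\in D$, cover $X$, and each $d$ is a contraction with respect to the maximum metric on $X^{\mathrm{ar}(d)}$. It is *well-covering* if every $x\in X$ lies in the interior of $\mathrm{range}(d)$ for some $d\in D$. Let $Q=\{u_0,u_1,\dots\}$ be a countable dense subset of $X$ (its elements are called basic; computations on $Q$ are computations on indices), and similarly $Q'$ for a metric space $(X',\rho')$. A map $h\colon X^m\to X'$ is *computable* if there is a computable $\zeta\colon\mathbb Q_+\to\mathbb Q_+$ such that $\rho(\vec x,\vec y)<\zeta(\varepsilon)$ implies $\rho'(h(\vec x),h(\vec y))<\varepsilon$, and there is an algorithm that, given $\vec u\in Q^m$ and $n\in\mathbb N$, outputs some $v\in Q'$ with $\rho'(h(\vec u),v)<2^{-n}$. A digit space with such a $Q$, $(X,D,Q)$, is a *computable digit space* if $\{(u,v,r)\in Q^2\times\mathbb Q : \rho(u,v)<r\}$ and $\{(u,v,r)\in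 Q^2\times\mathbb Q:\rho(u,v)>r\}$ are recursively enumerable and every $d\in D$ is computable. It is *decidable* if for $u\in Q$, $\theta\in\mathbb Q_+$, $d\in D$ it is decidable whether the open ball $B(u,\theta)$ is contained in $\mathrm{range}(d)$. It has *approximable choice* if for every $d\in D$ there is an effective procedure $(\theta,u)\mapsto v^\theta_u\in Q^{\mathrm{ar}(d)}$, defined for $\theta\in\mathbb Q_+$ and $u\in Q\cap\mathrm{int}(\mathrm{range}(d))$, such that for all such $\theta$: (1) $\rho(v^\theta_u,v^{\tilde\theta}_u)<\max\{\theta,\tilde\theta\}$ for all $u$ and $\tilde\theta\in\mathbb Q_+$; (2) one can compute from $\theta$ some $\theta'\in\mathbb Q_+$ such that $\rho(u,u')<\theta'$ implies $\rho(v^\theta_u,v^\theta_{u'})<\theta$ for all $u,u'$; (3) for all $u$ there is $\vec y\in d^{-1}[\{u\}]$ with $\rho(\vec y,v^\theta_u)<\theta$ (here $u,u'$ range over $Q\cap\mathrm{int}(\mathrm{range}(d))$). **The class.** Let $(X,D)$, $(Y,E)$ be extended IFS and $\mathbb F(X,Y)$ the set of all maps $f\colon X^m\to Y$, $m\ge 0$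 (write $\mathrm{ar}(f)=m$). For $d\in D$ and $1\le i\le m$ let $d^{(i,m)}\colon X^{\mathrm{ar}(d)+m-1}\to X^m$ apply $d$ to the $\mathrm{ar}(d)$ arguments starting at position $i$ and leave the other arguments unchanged. For $F\subseteq\mathbb F(X,Y)$ let $\mathcal J(F)$ be the least $G\subseteq\mathbb F(X,Y)$ such that * (W) if $e\in E$ and $f_1,\dots,f_{\mathrm{ar}(e)}\in F$ have the same arity, then $\vec x\mapsto e(f_1(\vec x),\dots,f_{\mathrm{ar}(e)}(\vec x))$ is in $G$; * (R) if $h\in\mathbb F(X,Y)$, $1\le i\le\mathrm{ar}(h)$ and $h\circ d^{(i,\mathrm{ar}(h))}\in G$ for all $d\in D$, then $h\in G$. Let $\mathbb C_{\mathbb F(X,Y)}$ be the greatest fixed point of $\mathcal J$. Membership in it is understood constructively, that is, through realisers: infinite trees whose nodes are either *writing nodes*, labelled with some $e\in E$ and having $\mathrm{ar}(e)$ immediate subtrees, or *reading nodes*, labelled with a letter $R_i$ and having one immediate subtree for each $d\in D$. The relation "$T$ realises $f\in\mathbb C_{\mathbb F(X,Y)}$" is defined by the same nested fixed points: it is $\nu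 \mathcal F.\,\mu\mathcal G.\,\tilde\Phi(\mathcal F)(\mathcal G)$, where $(T,f)\in\tilde\Phi(\mathcal F)(\mathcal G)$ iff either the root of $T$ is a writing node with label $e$ and $f=e(f_1(\cdot),\dots,f_{\mathrm{ar}(e)}(\cdot))$ for some $f_\kappa$ of arity $\mathrm{ar}(f)$ with $(T_\kappa,f_\kappa)\in\mathcal F$ for every immediate subtree $T_\kappa$, or the root is a reading node with label $R_i$, $1\le i\le\mathrm{ar}(f)$, and $(T_d,f\circ d^{(i,\mathrm{ar}(f))})\in\mathcal G$ for all $d\in D$. **Theorem.** Let $(X,D,Q_X)$ and $(Y,E,Q_Y)$ be decidable and well-covering computable digit spaces with approximable choice. Then $\mathbb C_{\mathbb F(X,Y)}$, understood constructively, is the class of computable maps in $\mathbb F(X,Y)$. Explicitly: a map $f\in\mathbb F(X,Y)$ belongs to the set $\mathbb C_{\mathbb F(X,Y)}$ if and only if some tree realises $f\in\mathbb C_{\mathbb F(X,Y)}$, and $$\{f\in\mathbb F(X,Y) : \text{some computable tree realises } f\in\mathbb C_{\mathbb F(X,Y)}\}=\{f\in\mathbb F(X,Y) : f \text{ is computable}\}.$$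 -/

import Mathlib

namespace DigitSpaces

/-! ### Extended iterated function systems and digit spaces -/

/-- The maps of an extended iterated function system on `X`: a finite family of continuous maps
`digit d : X ^ (ar d) → X` of positive arity. -/
structure ExtendedIFS (X : Type*) [TopologicalSpace X] where
  /-- The number of digits. -/
  size : ℕ
  /-- The arity of a digit. -/
  ar : Fin size → ℕ
  ar_pos : ∀ d, 0 < ar d
  /-- The map belonging to a digit. -/
  digit : (d : Fin size) → (Fin (ar d) → X) → X
  continuous_digit : ∀ d, Continuous (digit d)

section Spaces

variable {X : Type*} [MetricSpace X]

/-- `(X, D)` is a digit space: `X` is a non-empty compact metric space, the ranges of the digits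
cover `X`, and every digit is a contraction with respect to the maximum metric on powers of `X`
(which is the metric Mathlib puts on `Fin n → X`). -/
structure IsDigitSpace (D : ExtendedIFS X) : Prop where
  nonempty : Nonempty X
  compact : CompactSpace X
  covering : ∀ x : X, ∃ d, x ∈ Set.range (D.digit d)
  contracting : ∀ d, ∃ K : NNReal, K < 1 ∧ LipschitzWith K (D.digit d)

/-- Every point lies in the interior of the range of some digit. -/
def IsWellCovering (D : ExtendedIFS X) : Prop :=
  ∀ x : X, ∃ d, x ∈ interior (Set.range (D.digit d))

end Spaces

/-! ### Computability

A countable dense subset with its coding is given by a sequence `Q : ℕ → X` with dense range;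
procedures on basic elements work on indices. -/

/-- The positive rational coded by a pair of natural numbers. -/
noncomputable def posRat (c : ℕ × ℕ) : ℝ := ((c.1 : ℝ) + 1) / ((c.2 : ℝ) + 1)

/-- The rational number coded by a triple of natural numbers. -/
noncomputable def ratOf (c : ℕ × ℕ × ℕ) : ℝ := ((c.1 : ℝ) - (c.2.1 : ℝ)) / ((c.2.2 : ℝ) + 1)

section Computability

variable {X : Type*} [MetricSpace X] {Y : Type*} [MetricSpace Y]

/-- `(X, Q)` is a computable metric space. -/
structure IsComputableMetric (Q : ℕ → X) : Prop where
  dense : DenseRange Q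
  lt_re : REPred fun p : ℕ × ℕ × (ℕ × ℕ × ℕ) => dist (Q p.1) (Q p.2.1) < ratOf p.2.2
  gt_re : REPred fun p : ℕ × ℕ × (ℕ × ℕ × ℕ) => ratOf p.2.2 < dist (Q p.1) (Q p.2.1)

/-- A map `h : X ^ m → Y` is computable: it has a computable modulus of uniform continuity, and
there is a procedure that, given `u ∈ Q ^ m` and `n`, computes a basic element of `Y` at distance
less than `2⁻ⁿ` from `h u`. -/
def IsComputableMap (Q : ℕ → X) (Q' : ℕ → Y) {m : ℕ} (h : (Fin m → X) → Y) : Prop :=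
  (∃ ζ : ℕ × ℕ → ℕ × ℕ, Computable ζ ∧
    ∀ (ε : ℕ × ℕ) (x y : Fin m → X), dist x y < posRat (ζ ε) → dist (h x) (h y) < posRat ε) ∧
  ∃ G : (Fin m → ℕ) × ℕ → ℕ, Computable G ∧
    ∀ (u : Fin m → ℕ) (n : ℕ), dist (h fun k => Q (u k)) (Q' (G (u, n))) < (1 / 2 : ℝ) ^ n

/-- `(X, D, Q)` is a computable digit space. -/
structure IsComputableDigitSpace (D : ExtendedIFS X) (Q : ℕ → X) : Prop where
  digitSpace : IsDigitSpace D
  computableMetric : IsComputableMetric Q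
  computable_digit : ∀ d, IsComputableMap Q Q (D.digit d)

/-- For basic `u`, positive rational `θ` and a digit `d` it can be decided whether the open ball
`B(u, θ)` is contained in the range of `d`. -/
def IsDecidable (D : ExtendedIFS X) (Q : ℕ → X) : Prop :=
  ComputablePred fun p : ℕ × (ℕ × ℕ) × Fin D.size =>
    Metric.ball (Q p.1) (posRat p.2.1) ⊆ Set.range (D.digit p.2.2)

/-- Approximable choice. For each digit `d` there is a function `v` assigning to `θ` and to
`u ∈ int (range d) ∩ Q` an element of `Q ^ (ar d)`; the procedure `p` computing it has to terminate
on these arguments only. The computable function `t` yields the `θ'` of the second condition. -/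
def HasApproximableChoice (D : ExtendedIFS X) (Q : ℕ → X) : Prop :=
  ∀ d : Fin D.size,
    ∃ (v : ℕ × ℕ → ℕ → Fin (D.ar d) → ℕ) (p : (ℕ × ℕ) × ℕ →. (Fin (D.ar d) → ℕ))
      (t : ℕ × ℕ → ℕ × ℕ),
      Partrec p ∧ Computable t ∧
      (∀ θ u, Q u ∈ interior (Set.range (D.digit d)) → v θ u ∈ p (θ, u)) ∧
      ∀ θ : ℕ × ℕ,
        (∀ u, Q u ∈ interior (Set.range (D.digit d)) → ∀ θ₁ : ℕ × ℕ,
          dist (fun k => Q (v θ u k)) (fun k => Q (v θ₁ u k)) < max (posRat θ) (posRat θ₁)) ∧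
        (∀ u u', Q u ∈ interior (Set.range (D.digit d)) →
          Q u' ∈ interior (Set.range (D.digit d)) → dist (Q u) (Q u') < posRat (t θ) →
          dist (fun k => Q (v θ u k)) (fun k => Q (v θ u' k)) < posRat θ) ∧
        (∀ u, Q u ∈ interior (Set.range (D.digit d)) →
          ∃ y : Fin (D.ar d) → X, D.digit d y = Q u ∧ dist y (fun k => Q (v θ u k)) < posRat θ)

end Computability

/-! ### The inductive/co-inductive class -/

/-- All maps `X ^ m → Y`, for `m ≥ 0`. -/
abbrev Maps (X Y : Type*) := Σ m : ℕ, (Fin m → X) → Y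

/-- `plug d i` is the map `d^(i, m) : X ^ (n + m - 1) → X ^ m`,
`(x₁, …, xᵢ₋₁, y₁, …, yₙ, xᵢ₊₁, …, xₘ) ↦ (x₁, …, xᵢ₋₁, d (y₁, …, yₙ), xᵢ₊₁, …, xₘ)`
(here with indices starting at `0`). -/
def plug {X : Type*} {n m : ℕ} (d : (Fin n → X) → X) (i : Fin m) (x : Fin (n + m - 1) → X) :
    Fin m → X := fun j =>
  if h₁ : (j : ℕ) < i then x ⟨j, by omega⟩
  else if h₂ : (j : ℕ) = i then d fun k => x ⟨i + k, by omega⟩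
  else x ⟨j + n - 1, by omega⟩

section Class

variable {X : Type*} [TopologicalSpace X] {Y : Type*} [TopologicalSpace Y]

/-- The operator `Φ(F)(G)`: the first alternative is the write rule
`f = e ∘ (f₁ × ⋯ × f_{ar e})`, where `(f₁ × ⋯ × fᵣ)(x) = (f₁ x, …, fᵣ x)`, and the second one
is the read rule. -/
def Phi (D : ExtendedIFS X) (E : ExtendedIFS Y) (F G : Set (Maps X Y)) : Set (Maps X Y) :=
  {f | (∃ (e : Fin E.size) (g : Fin (E.ar e) → (Fin f.1 → X) → Y),
          (∀ k, (⟨f.1, g k⟩ : Maps X Y) ∈ F) ∧ f.2 = fun x => E.digit e fun k => g k x) ∨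
       ∃ i : Fin f.1, ∀ d : Fin D.size,
          (⟨D.ar d + f.1 - 1, f.2 ∘ plug (D.digit d) i⟩ : Maps X Y) ∈ G}

theorem Phi_mono (D : ExtendedIFS X) (E : ExtendedIFS Y) {F F' G G' : Set (Maps X Y)}
    (hF : F ⊆ F') (hG : G ⊆ G') : Phi D E F G ⊆ Phi D E F' G' := by
  rintro f (⟨e, g, h, hf⟩ | ⟨i, h⟩)
  · exact Or.inl ⟨e, g, fun k => hF (h k), hf⟩
  · exact Or.inr ⟨i, fun d => hG (h d)⟩

/-- `J(F) = μ G. Φ(F)(G)`, as a monotone operator in `F`. -/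
def J (D : ExtendedIFS X) (E : ExtendedIFS Y) : Set (Maps X Y) →o Set (Maps X Y) where
  toFun F := OrderHom.lfp ⟨Phi D E F, fun _ _ h => Phi_mono D E subset_rfl h⟩
  monotone' _ _ h := OrderHom.lfp.monotone fun _ => Phi_mono D E h subset_rfl

/-- The class `ℂ_{𝔽(X, Y)} = ν F. μ G. Φ(F)(G)`. -/
def CF (D : ExtendedIFS X) (E : ExtendedIFS Y) : Set (Maps X Y) := OrderHom.gfp (J D E)

end Class

/-! ### Infinite labelled trees -/

/-- Infinite trees with nodes labelled by elements of `A`, where a node with label `a` has exactly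
`ar a` immediate successors (numbered from `0`). A tree is the partial labelling of the words over
`ℕ`; its set of nodes is the domain of the labelling. -/
structure LTree (A : Type*) (ar : A → ℕ) where
  label : List ℕ → Option A
  root_isSome : (label []).isSome
  compatible : ∀ (s : List ℕ) (i : ℕ),
    (label (s ++ [i])).isSome ↔ ∃ a, label s = some a ∧ i < ar a

namespace LTree

variable {A : Type*} {ar : A → ℕ}

/-- The label of the root. -/
def root (T : LTree A ar) : A := (T.label []).get T.root_isSome

/-- The `i`-th immediate subtree. -/
def subtree (T : LTree A ar) (i : ℕ) (hi : i < ar T.root) : LTree A ar where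
  label s := T.label (i :: s)
  root_isSome := (T.compatible [] i).2 ⟨T.root, (Option.some_get T.root_isSome).symm, hi⟩
  compatible s j := T.compatible (i :: s) j

/-- A tree is computable if its labelling is. -/
def IsComputable [Primcodable A] (T : LTree A ar) : Prop := Computable T.label

end LTree

/-! ### Realisers of membership in the class -/

section Realisers

variable {X : Type*} [TopologicalSpace X] {Y : Type*} [TopologicalSpace Y]

/-- Labels of realisers: a digit `e` of `Y` (writing node) or a letter `R_i` (reading node). -/
abbrev Label (E : ExtendedIFS Y) := Fin E.size ⊕ ℕ

/-- A writing node labelled `e` has `ar e` successors, a reading node has one for each digit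
of `X`. -/
def labelAr (D : ExtendedIFS X) (E : ExtendedIFS Y) : Label E → ℕ :=
  Sum.elim E.ar fun _ => D.size

/-- The trees that can be realisers. -/
abbrev FTree (D : ExtendedIFS X) (E : ExtendedIFS Y) := LTree (Label E) (labelAr D E)

/-- The realisability version of `Φ(F)(G)`: the tree shows which alternative holds, together with
the digit `e` and the realisers of the `f_k`, respectively the index `i` and the realisers for the
maps `f ∘ d^(i, m)`. -/
def RPhi (D : ExtendedIFS X) (E : ExtendedIFS Y) (F G : Set (FTree D E × Maps X Y)) :
    Set (FTree D E × Maps X Y) :=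
  {p | (∃ (e : Fin E.size) (he : p.1.root = Sum.inl e)
          (g : Fin (E.ar e) → (Fin p.2.1 → X) → Y),
          (∀ k : Fin (E.ar e),
            (p.1.subtree k (by rw [he]; exact k.2), (⟨p.2.1, g k⟩ : Maps X Y)) ∈ F) ∧
          p.2.2 = fun x => E.digit e fun k => g k x) ∨
       ∃ (i : Fin p.2.1) (hi : p.1.root = Sum.inr (i : ℕ)), ∀ d : Fin D.size,
          (p.1.subtree d (by rw [hi]; exact d.2),
            (⟨D.ar d + p.2.1 - 1, p.2.2 ∘ plug (D.digit d) i⟩ : Maps X Y)) ∈ G}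

theorem RPhi_mono (D : ExtendedIFS X) (E : ExtendedIFS Y)
    {F F' G G' : Set (FTree D E × Maps X Y)}
    (hF : F ⊆ F') (hG : G ⊆ G') : RPhi D E F G ⊆ RPhi D E F' G' := by
  rintro p (⟨e, he, g, h, hf⟩ | ⟨i, hi, h⟩)
  · exact Or.inl ⟨e, he, g, fun k => hF (h k), hf⟩
  · exact Or.inr ⟨i, hi, fun d => hG (h d)⟩

/-- `μ G. RΦ(F)(G)`, as a monotone operator in `F`. -/
def RJ (D : ExtendedIFS X) (E : ExtendedIFS Y) :
    Set (FTree D E × Maps X Y) →o Set (FTree D E × Maps X Y) where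
  toFun F := OrderHom.lfp ⟨RPhi D E F, fun _ _ h => RPhi_mono D E subset_rfl h⟩
  monotone' _ _ h := OrderHom.lfp.monotone fun _ => RPhi_mono D E h subset_rfl

/-- `T` realises the statement `f ∈ ℂ_{𝔽(X, Y)}`. -/
def Realises (D : ExtendedIFS X) (E : ExtendedIFS Y) (T : FTree D E) (f : Maps X Y) : Prop :=
  (T, f) ∈ OrderHom.gfp (RJ D E)

end Realisers

end DigitSpaces

/-!
A realiser is produced by unfolding a transition system: if every state, together with the map it
stands for, passes one stage of `RPhi` with finitely many readings before each writing, then the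
unfolded tree realises the map. The states can be the elements of `CF D E` themselves, since there
are only finitely many digits and hence every stage of the inner induction needs them only through
choice.

*Realised maps are computable.* To approximate `f` at basic points, descend the tree until
sufficiently many writing nodes have been passed on the branch. At a reading node an argument is
replaced by its preimage under a digit of `D` whose range contains a ball around it; approximable
choice makes this preimage computable and extends it to a uniformly continuous right inverse of the
digit. Since the digits of `E` are contractions and `Y` is bounded, cutting off below `N` writing
nodes costs at most `K ^ N * diam Y`.

*Computable maps are realised.* For computable `f`, read the arguments until each of them has been
read so often that, the digits of `D` being contractions, `f` varies by less than a Lebesgue number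
of the covering of `Y` by the ranges of the digits of `E`. Then all values of `f` lie in the range
of one digit `e`, which is written, and the process continues with the components of `sec e ∘ f`,
where `sec e` is the right inverse of `e`; these are again computable. A reading of an argument read
`a` times so far lowers the sum of the weights `(A + 1) ^ (N - a)`, where `A` bounds the arities, so
that only finitely many readings happen between two writings.
-/

open Encodable Nat.Partrec

namespace DigitSpaces

/-! ### Recursion theory -/

section Computable

variable {α β γ σ : Type*} [Primcodable α] [Primcodable β] [Primcodable γ] [Primcodable σ]

attribute [fun_prop] Computable Computable.id Computable.const Computable.comp

@[fun_prop]
theorem computable_fst {f : α → β × γ} (hf : Computable f) : Computable fun a => (f a).1 :=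
  Computable.fst.comp hf

@[fun_prop]
theorem computable_snd {f : α → β × γ} (hf : Computable f) : Computable fun a => (f a).2 :=
  Computable.snd.comp hf

@[fun_prop]
theorem computable_prodMk {f : α → β} {g : α → γ} (hf : Computable f) (hg : Computable g) :
    Computable fun a => (f a, g a) :=
  hf.pair hg

@[fun_prop]
theorem computable_optionElim {f : α → Option β} {g : α → γ} {h : α → β → γ} (hf : Computable f)
    (hg : Computable g) (hh : Computable fun p : α × β => h p.1 p.2) :
    Computable fun a => (f a).elim (g a) (h a) :=
  (Computable.option_casesOn hf hg hh.to₂).of_eq fun a => by cases f a <;> rfl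

@[fun_prop]
theorem computable_sumElim {f : α → β ⊕ γ} {g : α → β → σ} {h : α → γ → σ} (hf : Computable f)
    (hg : Computable fun p : α × β => g p.1 p.2) (hh : Computable fun p : α × γ => h p.1 p.2) :
    Computable fun a => Sum.elim (g a) (h a) (f a) :=
  (Computable.sumCasesOn hf hg.to₂ hh.to₂).of_eq fun a => by cases f a <;> rfl

@[fun_prop]
theorem computable_fin_val {n : ℕ} {f : α → Fin n} (hf : Computable f) :
    Computable fun a => (f a : ℕ) :=
  Primrec.fin_val.to_comp.comp hf

@[fun_prop]
theorem computable_add {f g : α → ℕ} (hf : Computable f) (hg : Computable g) :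
    Computable fun a => f a + g a :=
  Primrec.nat_add.to_comp.comp hf hg

@[fun_prop]
theorem computable_sub {f g : α → ℕ} (hf : Computable f) (hg : Computable g) :
    Computable fun a => f a - g a :=
  Primrec.nat_sub.to_comp.comp hf hg

@[fun_prop]
theorem computable_ite_lt {f g : α → ℕ} {h k : α → σ} (hf : Computable f) (hg : Computable g)
    (hh : Computable h) (hk : Computable k) :
    Computable fun a => if f a < g a then h a else k a :=
  (Computable.cond (Primrec.nat_lt.decide.to_comp.comp hf hg) hh hk).of_eq fun a => by
    by_cases h : f a < g a <;> simp [h]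

@[fun_prop]
theorem computable_cons {f : α → β} {g : α → List β} (hf : Computable f) (hg : Computable g) :
    Computable fun a => f a :: g a :=
  Computable.list_cons.comp hf hg

@[fun_prop]
theorem computable_append {f g : α → List β} (hf : Computable f) (hg : Computable g) :
    Computable fun a => f a ++ g a :=
  Computable.list_append.comp hf hg

@[fun_prop]
theorem computable_head? {f : α → List β} (hf : Computable f) : Computable fun a => (f a).head? :=
  Primrec.list_head?.to_comp.comp hf

@[fun_prop]
theorem computable_tail {f : α → List β} (hf : Computable f) : Computable fun a => (f a).tail :=
  Primrec.list_tail.to_comp.comp hf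

@[fun_prop]
theorem computable_take {f : α → List β} {g : α → ℕ} (hf : Computable f) (hg : Computable g) :
    Computable fun a => (f a).take (g a) :=
  Primrec.list_take.to_comp.comp hg hf

@[fun_prop]
theorem computable_drop {f : α → List β} {g : α → ℕ} (hf : Computable f) (hg : Computable g) :
    Computable fun a => (f a).drop (g a) :=
  Primrec.list_drop.to_comp.comp hg hf

@[fun_prop]
theorem computable_getD {f : α → List β} {g : α → ℕ} (d : β) (hf : Computable f)
    (hg : Computable g) : Computable fun a => (f a).getD (g a) d :=
  (Primrec.list_getD d).to_comp.comp hf hg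

@[fun_prop]
theorem computable_length {f : α → List β} (hf : Computable f) : Computable fun a => (f a).length :=
  Computable.list_length.comp hf

theorem mem_mapM {α σ : Type*} {g : α → Part σ} {l : List α} {r : List σ}
    (h : List.Forall₂ (fun a v => v ∈ g a) l r) : r ∈ l.mapM g := by
  induction h with
  | nil => exact Part.mem_some _
  | cons ha _ ih =>
    rw [List.mapM_cons]
    exact Part.mem_bind ha (Part.mem_bind ih (Part.mem_some _))

theorem partrec_mapM {g : α → β → Part σ} (hg : Partrec₂ g) :
    Partrec₂ fun a (l : List β) => (l.mapM (g a) : Part (List σ)) := by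
  let step (p : α × List β) (s : ℕ × List σ) : Part (List σ) :=
    (p.2[s.1]? : Part β).bind fun b => (g p.1 b).map fun v => s.2 ++ [v]
  have partrec_step : Partrec₂ step := by
    have partrec_g : Partrec₂ fun (t : (α × List β) × ℕ × List σ) b => g t.1.1 b :=
      hg.comp (g := fun t : ((α × List β) × ℕ × List σ) × β => t.1.1.1) (by fun_prop)
        Computable.snd
    have computable_snoc : Computable₂
        fun (t : ((α × List β) × ℕ × List σ) × β) v => t.1.2.2 ++ [v] := by
      unfold Computable₂
      fun_prop
    exact Partrec.bind (Computable.ofOption (Computable.list_getElem?.comp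
      (by fun_prop) (by fun_prop))) (partrec_g.map computable_snoc)
  have mapM_take (a : α) (l : List β) (n : ℕ) (hn : n ≤ l.length) :
      (n.rec (Part.some []) fun j r => r.bind fun acc => step (a, l) (j, acc) : Part (List σ)) =
        (l.take n).mapM (g a) := by
    induction n with
    | zero => simp
    | succ n ih =>
      simp only [ih (by lia)]
      simp only [step, List.take_add_one, List.mapM_append,
        List.getElem?_eq_getElem hn, Part.coe_some, Part.bind_some, Option.toList_some,
        List.mapM_cons, List.mapM_nil, Part.bind_eq_bind, Part.pure_eq_some, Part.bind_assoc,
        ← Part.bind_some_eq_map]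
  refine (Partrec.nat_rec (f := fun p : α × List β => p.2.length) (by fun_prop)
    (Computable.const []) partrec_step).of_eq fun p => ?_
  exact (mapM_take p.1 p.2 _ le_rfl).trans (by rw [List.take_length])

@[fun_prop]
theorem computable_map {f : α → List β} {g : α → β → σ} (hf : Computable f)
    (hg : Computable fun p : α × β => g p.1 p.2) : Computable fun a => (f a).map (g a) := by
  refine ((partrec_mapM (g := fun a b => Part.some (g a b)) hg.partrec).comp Computable.id
    hf).of_eq_tot fun a => ?_
  have mapM_some : (f a).mapM (fun b => Part.some (g a b)) = Part.some ((f a).map (g a)) :=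
    List.mapM_pure
  exact mapM_some ▸ Part.mem_some _

@[fun_prop]
theorem computable_replicate {f : α → ℕ} {g : α → β} (hf : Computable f) (hg : Computable g) :
    Computable fun a => List.replicate (f a) (g a) :=
  (computable_map (g := fun a _ => g a) (Primrec.list_range.to_comp.comp hf) (by fun_prop)).of_eq
    fun a => by simp

/-- The partial function between coded types that is computed by a code. -/
def evalAs (α σ : Type*) [Primcodable α] [Primcodable σ] (c : Code) (a : α) : Part σ :=
  (c.eval (encode a)).bind fun n => ((decode n : Option σ) : Part σ)

theorem partrec_evalAs : Partrec₂ (evalAs α σ) :=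
  (Code.eval_part.comp Computable.fst (Computable.encode.comp Computable.snd)).bind
    (Computable.ofOption (Computable.decode.comp Computable.snd)).to₂

theorem exists_evalAs_eq_self {F : Code → α → Part σ} (hF : Partrec₂ F) :
    ∃ c, ∀ a, evalAs α σ c a = F c a := by
  have partrec_coded : Partrec₂ fun (c : Code) n =>
      ((decode n : Option α) : Part α).bind fun a => (F c a).map encode :=
    Partrec.bind (Computable.ofOption (Computable.decode.comp Computable.snd))
      (Partrec.map (hF.comp (Computable.fst.comp Computable.fst) Computable.snd)
        (Computable.encode.comp Computable.snd))
  obtain ⟨c, hc⟩ := Code.fixed_point₂ partrec_coded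
  refine ⟨c, fun a => ?_⟩
  simp only [evalAs, hc, encodek, Part.coe_some, Part.bind_some]
  simp only [Part.bind_map, encodek, Part.coe_some, Part.bind_some_right]

theorem exists_partrec_rec {calls : α → Part (List α)} {combine : α → List σ → σ}
    (hcalls : Partrec calls) (hcombine : Computable fun p : α × List σ => combine p.1 p.2) :
    ∃ g : α → Part σ, Partrec g ∧ ∀ a l r, l ∈ calls a →
      List.Forall₂ (fun b v => v ∈ g b) l r → combine a r ∈ g a := by
  have computable_combine : Computable₂ fun (p : (Code × α) × List α) r => combine p.1.2 r := by
    unfold Computable₂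
    fun_prop
  have partrec_unfolded : Partrec₂ fun (c : Code) a => (calls a).bind fun l =>
      (l.mapM (evalAs α σ c) : Part (List σ)).map (combine a) :=
    Partrec.bind (hcalls.comp Computable.snd)
      (Partrec.map ((partrec_mapM partrec_evalAs).comp (Computable.fst.comp Computable.fst)
        Computable.snd) computable_combine)
  obtain ⟨c, hc⟩ := exists_evalAs_eq_self partrec_unfolded
  refine ⟨evalAs α σ c, partrec_evalAs.comp (Computable.const c) Computable.id,
    fun a l r hl hr => ?_⟩
  rw [hc]
  exact Part.mem_bind hl (Part.mem_map _ (mem_mapM hr))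

theorem computable_list_rec_param {f : List β → γ → σ} {base : γ → σ} {pre : β → γ → γ}
    {post : β → γ → σ → σ} (hbase : Computable base)
    (hpre : Computable fun p : β × γ => pre p.1 p.2)
    (hpost : Computable fun p : β × γ × σ => post p.1 p.2.1 p.2.2)
    (f_nil : ∀ a, f [] a = base a)
    (f_cons : ∀ b l a, f (b :: l) a = post b a (f l (pre b a))) :
    Computable fun p : List β × γ => f p.1 p.2 := by
  let calls (p : List β × γ) : List (List β × γ) :=
    p.1.head?.elim [] fun b => [(p.1.tail, pre b p.2)]
  let combine (p : List β × γ) (v : List σ) : σ :=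
    p.1.head?.elim (base p.2) fun b => v.head?.elim (base p.2) (post b p.2)
  have computable_calls : Computable calls := by fun_prop
  have computable_combine : Computable fun p : (List β × γ) × List σ => combine p.1 p.2 := by
    fun_prop
  obtain ⟨r, partrec_r, mem_r⟩ := exists_partrec_rec computable_calls.partrec computable_combine
  refine Partrec.of_eq_tot partrec_r ?_
  rintro ⟨l, a⟩
  induction l generalizing a with
  | nil => exact f_nil a ▸ mem_r ([], a) [] [] (Part.mem_some _) .nil
  | cons b l ih =>
    rw [f_cons]
    exact mem_r (b :: l, a) [(l, pre b a)] [f l (pre b a)] (Part.mem_some _) (.cons (ih _) .nil)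

theorem computable_fin_apply {n : ℕ} {f : Fin n → α → σ} {i : α → Fin n}
    (hf : ∀ i, Computable (f i)) (hi : Computable i) : Computable fun a => f (i a) a :=
  (Computable.vector_get.comp (Computable.vector_ofFn hf) hi).of_eq fun a => by simp

end Computable

/-! ### Unfolding transition systems into trees -/

namespace LTree

variable {A S : Type*} {ar : A → ℕ}

@[ext]
theorem ext {T T' : LTree A ar} (h : ∀ s, T.label s = T'.label s) : T = T' := by
  cases T
  cases T'
  congr
  exact funext h

theorem label_nil_eq (T : LTree A ar) : T.label [] = some T.root :=
  (Option.some_get T.root_isSome).symm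

/-- The label reached from a state of a transition system along a word, if there is one. -/
def unfoldLabel (ar : A → ℕ) (lab : S → A) (child : S → ℕ → S) : List ℕ → S → Option A
  | [], σ => some (lab σ)
  | i :: s, σ => if i < ar (lab σ) then unfoldLabel ar lab child s (child σ i) else none

/-- The tree of all runs of a transition system from a given state: a state `σ` has the label
`lab σ` and the successors `child σ i` for `i < ar (lab σ)`. -/
def unfold (ar : A → ℕ) (lab : S → A) (child : S → ℕ → S) (σ : S) : LTree A ar where
  label s := unfoldLabel ar lab child s σ
  root_isSome := rfl
  compatible s i := by
    induction s generalizing σ with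
    | nil => by_cases h : i < ar (lab σ) <;> simp [unfoldLabel, h]
    | cons j s ih =>
      by_cases h : j < ar (lab σ)
      · simpa [unfoldLabel, h] using ih (child σ j)
      · simp [unfoldLabel, h]

@[simp]
theorem root_unfold (lab : S → A) (child : S → ℕ → S) (σ : S) :
    (unfold ar lab child σ).root = lab σ := rfl

theorem subtree_unfold (lab : S → A) (child : S → ℕ → S) (σ : S) (i : ℕ)
    (hi : i < ar (unfold ar lab child σ).root) :
    (unfold ar lab child σ).subtree i hi = unfold ar lab child (child σ i) :=
  ext fun _ => if_pos hi

theorem isComputable_unfold [Primcodable A] [Primcodable S] {lab : S → A} {child : S → ℕ → S}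
    (har : Computable ar) (hlab : Computable lab)
    (hchild : Computable fun p : S × ℕ => child p.1 p.2) (σ : S) :
    (unfold ar lab child σ).IsComputable := by
  have computable_unfoldLabel :
      Computable fun p : List ℕ × S => unfoldLabel ar lab child p.1 p.2 :=
    computable_list_rec_param (base := fun σ => some (lab σ)) (pre := fun i σ => child σ i)
      (post := fun i σ a => if i < ar (lab σ) then a else none)
      (Computable.option_some.comp hlab) (by fun_prop) (by fun_prop)
      (fun _ => rfl) fun _ _ _ => rfl
  exact computable_unfoldLabel.comp (Computable.id.pair (Computable.const σ))

end LTree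

/-! ### The class and its realisers -/

section Class

variable {X : Type*} [TopologicalSpace X] {Y : Type*} [TopologicalSpace Y]
  {D : ExtendedIFS X} {E : ExtendedIFS Y}

theorem Phi_J (F : Set (Maps X Y)) : Phi D E F (J D E F) = J D E F :=
  OrderHom.map_lfp ⟨Phi D E F, fun _ _ h => Phi_mono D E subset_rfl h⟩

theorem J_subset {F G : Set (Maps X Y)} (h : Phi D E F G ⊆ G) : J D E F ⊆ G :=
  OrderHom.lfp_le _ h

theorem J_CF : J D E (CF D E) = CF D E :=
  OrderHom.map_gfp (J D E)

theorem RPhi_RJ (F : Set (FTree D E × Maps X Y)) : RPhi D E F (RJ D E F) = RJ D E F :=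
  OrderHom.map_lfp ⟨RPhi D E F, fun _ _ h => RPhi_mono D E subset_rfl h⟩

theorem RJ_subset {F G : Set (FTree D E × Maps X Y)} (h : RPhi D E F G ⊆ G) : RJ D E F ⊆ G :=
  OrderHom.lfp_le _ h

theorem Realises.mem_RJ {T : FTree D E} {f : Maps X Y} (h : Realises D E T f) :
    (T, f) ∈ RJ D E {p | Realises D E p.1 p.2} :=
  (OrderHom.map_gfp (RJ D E)).ge h

/-- The rule of the class named by a label `a`, applied backwards to `f`: the components of `f`
satisfy `W` if `a` is a writing label, and the composites of `f` with the digits of `X` satisfy `R`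
if `a` is a reading label. The first argument of `W` and `R` numbers the successors of the node. -/
def IsStep (D : ExtendedIFS X) (E : ExtendedIFS Y) (a : Label E) (W R : ℕ → Maps X Y → Prop)
    (f : Maps X Y) : Prop :=
  (∃ e, a = Sum.inl e ∧ ∃ g : Fin (E.ar e) → (Fin f.1 → X) → Y,
    (∀ k : Fin (E.ar e), W k ⟨f.1, g k⟩) ∧ f.2 = fun x => E.digit e fun k => g k x) ∨
  ∃ i : Fin f.1, a = Sum.inr (i : ℕ) ∧ ∀ d : Fin D.size,
    R d ⟨D.ar d + f.1 - 1, f.2 ∘ plug (D.digit d) i⟩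

theorem exists_isStep_of_mem_Phi {F G : Set (Maps X Y)} {f : Maps X Y} (hf : f ∈ Phi D E F G) :
    ∃ a, IsStep D E a (fun _ g => g ∈ F) (fun _ g => g ∈ G) f := by
  rcases hf with ⟨e, g, hg, hfg⟩ | ⟨i, hi⟩
  · exact ⟨.inl e, .inl ⟨e, rfl, g, hg, hfg⟩⟩
  · exact ⟨.inr i, .inr ⟨i, rfl, hi⟩⟩

theorem IsStep.mono {a : Label E} {W W' R R' : ℕ → Maps X Y → Prop} {f : Maps X Y}
    (h : IsStep D E a W R f) (hW : ∀ k g, W k g → W' k g) (hR : ∀ d g, R d g → R' d g) :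
    IsStep D E a W' R' f := by
  rcases h with ⟨e, he, g, hg, hfg⟩ | ⟨i, hi, hd⟩
  · exact .inl ⟨e, he, g, fun k => hW k _ (hg k), hfg⟩
  · exact .inr ⟨i, hi, fun d => hR d _ (hd d)⟩

theorem IsStep.exists_child {S : Type*} [Nonempty S] {a : Label E} {W R : S → Maps X Y → Prop}
    {f : Maps X Y} (h : IsStep D E a (fun _ g => ∃ σ, W σ g) (fun _ g => ∃ σ, R σ g) f) :
    ∃ child : ℕ → S, IsStep D E a (fun k => W (child k)) (fun d => R (child d)) f := by
  have extend {n : ℕ} (σ : Fin n → S) : ∃ child : ℕ → S, ∀ k : Fin n, child k = σ k :=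
    ⟨fun k => if h : k < n then σ ⟨k, h⟩ else Classical.arbitrary S, fun k => by simp⟩
  rcases h with ⟨e, he, g, hg, hfg⟩ | ⟨i, hi, hd⟩
  · choose σ hσ using hg
    obtain ⟨child, hchild⟩ := extend σ
    exact ⟨child, .inl ⟨e, he, g, fun k => by simpa only [hchild k] using hσ k, hfg⟩⟩
  · choose σ hσ using hd
    obtain ⟨child, hchild⟩ := extend σ
    exact ⟨child, .inr ⟨i, hi, fun d => by simpa only [hchild d] using hσ d⟩⟩

/-- Reading steps decrease a rank since realisers have no infinite path of reading nodes. -/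
theorem realises_unfold {S : Type*} {lab : S → Label E} {child : S → ℕ → S}
    {I : S → Maps X Y → Prop} {rank : S → ℕ}
    (isStep : ∀ σ f, I σ f → IsStep D E (lab σ) (fun k => I (child σ k))
      (fun d g => rank (child σ d) < rank σ ∧ I (child σ d) g) f)
    {σ : S} {f : Maps X Y} (h : I σ f) :
    Realises D E (LTree.unfold (labelAr D E) lab child σ) f := by
  let R : Set (FTree D E × Maps X Y) :=
    {p | ∃ σ, I σ p.2 ∧ p.1 = LTree.unfold (labelAr D E) lab child σ}
  suffices R_le : R ≤ RJ D E R from OrderHom.le_gfp _ R_le ⟨σ, h, rfl⟩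
  rintro ⟨_, f⟩ ⟨σ, hσ, rfl⟩
  induction hn : rank σ using Nat.strong_induction_on generalizing σ f with
  | _ n ih =>
    rw [← RPhi_RJ]
    rcases isStep σ f hσ with ⟨e, he, g, hg, hf⟩ | ⟨i, hi, hd⟩
    · refine .inl ⟨e, he, g, fun k => ⟨child σ k, hg k, ?_⟩, hf⟩
      exact LTree.subtree_unfold lab child σ k (by rw [LTree.root_unfold, he]; exact k.2)
    · refine .inr ⟨i, hi, fun d => ?_⟩
      dsimp only
      rw [LTree.subtree_unfold]
      exact ih _ (hn ▸ (hd d).1) _ _ (hd d).2 rfl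

/-- `Phi` is continuous in its second argument because there are only finitely many digits. -/
theorem exists_mem_iterate_Phi {f : Maps X Y} (hf : f ∈ CF D E) :
    ∃ n, f ∈ (Phi D E (CF D E))^[n] ∅ := by
  have monotone_stage : Monotone fun n => (Phi D E (CF D E))^[n] ∅ :=
    Monotone.monotone_iterate_of_le_map (fun _ _ h => Phi_mono D E subset_rfl h)
      (Set.empty_subset _)
  suffices CF_subset : CF D E ⊆ ⋃ n, (Phi D E (CF D E))^[n] ∅ from Set.mem_iUnion.1 (CF_subset hf)
  refine J_CF.symm.subset.trans (J_subset ?_)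
  rintro f (hwrite | ⟨i, hi⟩)
  · exact Set.mem_iUnion.2 ⟨1, .inl hwrite⟩
  · choose n hn using fun d => Set.mem_iUnion.1 (hi d)
    refine Set.mem_iUnion.2 ⟨Finset.univ.sup n + 1, ?_⟩
    rw [Function.iterate_succ_apply']
    exact .inr ⟨i, fun d => monotone_stage (Finset.le_sup (Finset.mem_univ d)) (hn d)⟩

theorem exists_realises_of_mem_CF {f : Maps X Y} (hf : f ∈ CF D E) :
    ∃ T : FTree D E, Realises D E T f := by
  let S := {p : ℕ × Maps X Y // p.2 ∈ (Phi D E (CF D E))^[p.1] ∅}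
  have exists_isStep (σ : S) : ∃ (a : Label E) (child : ℕ → S),
      IsStep D E a (fun k g => (child k).1.2 = g)
        (fun d g => (child d).1.1 < σ.1.1 ∧ (child d).1.2 = g) σ.1.2 := by
    obtain ⟨⟨_ | n, f⟩, hf⟩ := σ
    · exact hf.elim
    rw [Function.iterate_succ_apply'] at hf
    obtain ⟨a, isStep⟩ := exists_isStep_of_mem_Phi hf
    have : Nonempty S := ⟨⟨(n + 1, f), by rwa [Function.iterate_succ_apply']⟩⟩
    refine ⟨a, IsStep.exists_child (W := fun (σ : S) g => σ.1.2 = g)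
      (R := fun (σ : S) g => σ.1.1 < n + 1 ∧ σ.1.2 = g) (isStep.mono ?_ ?_)⟩
    · intro _ g hg
      obtain ⟨m, hm⟩ := exists_mem_iterate_Phi hg
      exact ⟨⟨(m, g), hm⟩, rfl⟩
    · intro _ g hg
      exact ⟨⟨(n, g), hg⟩, n.lt_succ_self, rfl⟩
  choose lab child isStep using exists_isStep
  obtain ⟨n, hn⟩ := exists_mem_iterate_Phi hf
  refine ⟨LTree.unfold (labelAr D E) lab child ⟨(n, f), hn⟩, realises_unfold
    (I := fun σ g => σ.1.2 = g) (rank := fun σ => σ.1.1) ?_ rfl⟩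
  rintro σ _ rfl
  exact isStep σ

theorem mem_CF_of_realises {T : FTree D E} {f : Maps X Y} (h : Realises D E T f) :
    f ∈ CF D E := by
  let S : Set (Maps X Y) := {f | ∃ T, Realises D E T f}
  suffices S_le : S ≤ J D E S from OrderHom.le_gfp _ S_le ⟨T, h⟩
  rintro f ⟨T, hT⟩
  suffices RJ_sub : RJ D E {p | Realises D E p.1 p.2} ⊆ {p | p.2 ∈ J D E S} from RJ_sub hT.mem_RJ
  refine RJ_subset ?_
  rintro ⟨T, f⟩ (⟨e, _, g, hg, hf⟩ | ⟨i, _, hd⟩)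
  · exact (Phi_J S).subset (.inl ⟨e, g, fun k => ⟨_, hg k⟩, hf⟩)
  · exact (Phi_J S).subset (.inr ⟨i, hd⟩)

theorem mem_CF_iff_exists_realises {f : Maps X Y} :
    f ∈ CF D E ↔ ∃ T : FTree D E, Realises D E T f :=
  ⟨exists_realises_of_mem_CF, fun ⟨_, h⟩ => mem_CF_of_realises h⟩

/-- The outer induction is on the number of writing nodes still to be passed, the inner one on the
reading nodes before the next of them. -/
theorem Realises.write_induction {P : ℕ → FTree D E → Maps X Y → Prop}
    (zero : ∀ T f, P 0 T f)
    (write : ∀ n T f e (he : T.root = Sum.inl e) (g : Fin (E.ar e) → (Fin f.1 → X) → Y),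
      (∀ k : Fin (E.ar e), P n (T.subtree k (by rw [he]; exact k.2)) ⟨f.1, g k⟩) →
      (f.2 = fun x => E.digit e fun k => g k x) → P (n + 1) T f)
    (read : ∀ n T f (i : Fin f.1) (hi : T.root = Sum.inr (i : ℕ)),
      (∀ d : Fin D.size, P (n + 1) (T.subtree d (by rw [hi]; exact d.2))
        ⟨D.ar d + f.1 - 1, f.2 ∘ plug (D.digit d) i⟩) → P (n + 1) T f)
    (n : ℕ) {T : FTree D E} {f : Maps X Y} (h : Realises D E T f) : P n T f := by
  induction n generalizing T f with
  | zero => exact zero T f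
  | succ n ih =>
    suffices RJ_sub : RJ D E {p | Realises D E p.1 p.2} ⊆ {p | P (n + 1) p.1 p.2} from
      RJ_sub h.mem_RJ
    refine RJ_subset ?_
    rintro ⟨T, f⟩ (⟨e, he, g, hg, hf⟩ | ⟨i, hi, hd⟩)
    · exact write n T f e he g (fun k => ih (hg k)) hf
    · exact read n T f i hi hd

end Class

/-! ### Basic points and effective data -/

section Dyadic

/-- The code of the rational number `2⁻ᵏ`. -/
def dyadic (k : ℕ) : ℕ × ℕ := (0, 2 ^ k - 1)

theorem posRat_dyadic (k : ℕ) : posRat (dyadic k) = (1 / 2 : ℝ) ^ k := by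
  simp [posRat, dyadic, Nat.cast_sub Nat.one_le_two_pow]

@[fun_prop]
theorem computable_dyadic : Computable dyadic := by
  have primrec_two_pow : Primrec fun k : ℕ => 2 ^ k :=
    (Primrec₂.unpaired'.1 Nat.Primrec.pow).comp (Primrec.const 2) Primrec.id
  exact (Primrec.pair (Primrec.const 0)
    (Primrec.nat_sub.comp primrec_two_pow (Primrec.const 1))).to_comp

theorem half_pow_le_posRat (c : ℕ × ℕ) : (1 / 2 : ℝ) ^ c.2 ≤ posRat c := by
  have add_one_le : (c.2 : ℝ) + 1 ≤ 2 ^ c.2 := by exact_mod_cast Nat.lt_two_pow_self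
  calc (1 / 2 : ℝ) ^ c.2 = 1 / 2 ^ c.2 := one_div_pow _ _
    _ ≤ 1 / (c.2 + 1) := by gcongr
    _ ≤ posRat c := by rw [posRat]; gcongr; simp

theorem posRat_pos (c : ℕ × ℕ) : 0 < posRat c := by
  rw [posRat]
  positivity

theorem half_pow_anti {k l : ℕ} (h : k ≤ l) : (1 / 2 : ℝ) ^ l ≤ (1 / 2 : ℝ) ^ k :=
  pow_le_pow_of_le_one (by norm_num) (by norm_num) h

theorem half_pow_succ (k : ℕ) : (1 / 2 : ℝ) ^ (k + 1) = (1 / 2 : ℝ) ^ k / 2 := by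
  rw [pow_succ, mul_one_div]

end Dyadic

section Tuple

/-- The tuple of basic points with the indices in a list, padded by `0`. Lists have the advantage
over tuples that their computability does not depend on their length. -/
def tuple {X : Type*} (Q : ℕ → X) (l : List ℕ) (m : ℕ) : Fin m → X := fun j => Q (l.getD j 0)

theorem tuple_ofFn {X : Type*} (Q : ℕ → X) {m : ℕ} (u : Fin m → ℕ) :
    tuple Q (List.ofFn u) m = fun j => Q (u j) := by
  funext j
  simp [tuple]

theorem computable_fin_getD (m : ℕ) :
    Computable fun (l : List ℕ) (j : Fin m) => l.getD (j : ℕ) 0 :=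
  Primrec.to_comp (Primrec.fin_curry.2
    ((Primrec.list_getD 0).comp Primrec.fst (Primrec.fin_val.comp Primrec.snd)))

@[fun_prop]
theorem computable_ofFn (m : ℕ) : Computable fun u : Fin m → ℕ => List.ofFn u :=
  (Primrec.vector_toList.comp Primrec.vector_ofFn').to_comp.of_eq fun u => by simp

variable {X : Type*} [MetricSpace X] {Y : Type*} [MetricSpace Y]

theorem IsComputableMap.exists_modulus {Q : ℕ → X} {Q' : ℕ → Y} {m : ℕ} {h : (Fin m → X) → Y}
    (hh : IsComputableMap Q Q' h) : ∃ ζ : ℕ → ℕ, Computable ζ ∧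
      ∀ k x y, dist x y < (1 / 2 : ℝ) ^ ζ k → dist (h x) (h y) < (1 / 2 : ℝ) ^ k := by
  obtain ⟨⟨ζ, hζ, dist_lt⟩, -⟩ := hh
  refine ⟨fun k => (ζ (dyadic k)).2, by fun_prop, fun k x y hxy => ?_⟩
  rw [← posRat_dyadic]
  exact dist_lt _ x y (hxy.trans_le (half_pow_le_posRat _))

theorem IsComputableMap.exists_approx {Q : ℕ → X} {Q' : ℕ → Y} {m : ℕ} {h : (Fin m → X) → Y}
    (hh : IsComputableMap Q Q' h) : ∃ G : List ℕ × ℕ → ℕ, Computable G ∧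
      ∀ l k, dist (h (tuple Q l m)) (Q' (G (l, k))) < (1 / 2 : ℝ) ^ k := by
  obtain ⟨-, G, hG, dist_lt⟩ := hh
  exact ⟨fun p => G (fun j => p.1.getD (j : ℕ) 0, p.2),
    hG.comp (((computable_fin_getD m).comp Computable.fst).pair Computable.snd),
    fun l k => dist_lt _ k⟩

theorem isComputableMap_of_approx {Q : ℕ → X} {Q' : ℕ → Y} (hQ : DenseRange Q) {m : ℕ}
    {h : (Fin m → X) → Y} {μ : ℕ → ℕ} (hμ : Computable μ) {v : List ℕ × ℕ →. ℕ} (hv : Partrec v)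
    (approx : ∀ l k, l.length = m → ∃ w ∈ v (l, k), ∀ x,
      dist x (tuple Q l m) < (1 / 2 : ℝ) ^ μ k → dist (h x) (Q' w) < (1 / 2 : ℝ) ^ k) :
    IsComputableMap Q Q' h := by
  choose w mem_v dist_lt using fun (u : Fin m → ℕ) k => approx (List.ofFn u) k List.length_ofFn
  simp only [tuple_ofFn] at dist_lt
  refine ⟨⟨fun ε => dyadic (μ (ε.2 + 1) + 1), by fun_prop, fun ε x y hxy => ?_⟩,
    fun p => w p.1 p.2, ?_, fun u k => dist_lt u k _ (by rw [dist_self]; positivity)⟩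
  · rw [posRat_dyadic, half_pow_succ] at hxy
    choose u hu using fun j => hQ.exists_dist_lt (x j) (ε := (1 / 2 : ℝ) ^ μ (ε.2 + 1) / 2)
      (by positivity)
    replace hu : dist x (fun j => Q (u j)) < _ := (dist_pi_lt_iff (by positivity)).2 hu
    have dist_hx := dist_lt u (ε.2 + 1) x (by linarith [dist_nonneg (x := x) (y := y)])
    have dist_hy := dist_lt u (ε.2 + 1) y (by linarith [dist_triangle_left y (fun j => Q (u j)) x])
    rw [half_pow_succ] at dist_hx dist_hy
    linarith [dist_triangle_right (h x) (h y) (Q' (w u (ε.2 + 1))), half_pow_le_posRat ε]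
  · exact Partrec.of_eq_tot (hv.comp (g := fun p : (Fin m → ℕ) × ℕ => (List.ofFn p.1, p.2))
      (by fun_prop)) fun p => mem_v p.1 p.2

end Tuple

section Contraction

variable {X : Type*} [MetricSpace X]

/-- What the proof uses of the digits of a computable digit space as maps: a contraction factor
`K`, a bound `B` of the diameter, and approximations of the digits at basic points. Iterating `n`
digits, where `depth k ≤ n`, determines a point up to `2⁻ᵏ`. -/
structure EffectiveContraction (D : ExtendedIFS X) (Q : ℕ → X) where
  K : ℝ
  K_nonneg : 0 ≤ K
  K_lt_one : K < 1
  dist_digit_le : ∀ d x y, dist (D.digit d x) (D.digit d y) ≤ K * dist x y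
  B : ℝ
  dist_le : ∀ x y : X, dist x y ≤ B
  depth : ℕ → ℕ
  computable_depth : Computable depth
  pow_mul_lt : ∀ k n, depth k ≤ n → K ^ n * B < (1 / 2 : ℝ) ^ k
  approx : Fin D.size → List ℕ × ℕ → ℕ
  computable_approx : Computable fun p : Fin D.size × List ℕ × ℕ => approx p.1 p.2
  dist_approx_lt : ∀ d l k,
    dist (D.digit d (tuple Q l (D.ar d))) (Q (approx d (l, k))) < (1 / 2 : ℝ) ^ k

theorem exists_contraction_factor {D : ExtendedIFS X} (h : IsDigitSpace D) :
    ∃ K : ℝ, 0 ≤ K ∧ K < 1 ∧ ∀ d x y, dist (D.digit d x) (D.digit d y) ≤ K * dist x y := by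
  choose K K_lt_one lipschitz using h.contracting
  refine ⟨(Finset.univ.sup K : NNReal), NNReal.coe_nonneg _, ?_, fun d => ?_⟩
  · exact_mod_cast (Finset.sup_lt_iff (by simp)).2 fun d _ => K_lt_one d
  · exact ((lipschitz d).weaken (Finset.le_sup (Finset.mem_univ d))).dist_le_mul

theorem exists_computable_pow_mul_lt {K : ℝ} (B : ℝ) (hK₀ : 0 ≤ K) (hK₁ : K < 1) :
    ∃ N : ℕ → ℕ, Computable N ∧ ∀ k n, N k ≤ n → K ^ n * B < (1 / 2 : ℝ) ^ k := by
  obtain ⟨a, ha⟩ := exists_pow_lt_of_lt_one one_half_pos hK₁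
  obtain ⟨b, hb⟩ := pow_unbounded_of_one_lt B one_lt_two
  refine ⟨fun k => a * (k + b), ?_, fun k n hn => ?_⟩
  · exact (Primrec.nat_mul.comp (Primrec.const a)
      (Primrec.nat_add.comp Primrec.id (Primrec.const b))).to_comp
  · have pow_le : K ^ n ≤ (1 / 2 : ℝ) ^ (k + b) :=
      calc K ^ n ≤ K ^ (a * (k + b)) := pow_le_pow_of_le_one hK₀ hK₁.le hn
        _ = (K ^ a) ^ (k + b) := pow_mul ..
        _ ≤ (1 / 2 : ℝ) ^ (k + b) := by gcongr
    calc K ^ n * B ≤ K ^ n * max B 0 := by gcongr; exact le_max_left _ _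
      _ ≤ (1 / 2 : ℝ) ^ (k + b) * max B 0 := by gcongr
      _ < (1 / 2 : ℝ) ^ (k + b) * 2 ^ b := by gcongr; exact max_lt hb (by positivity)
      _ = (1 / 2 : ℝ) ^ k := by rw [pow_add, mul_assoc, ← mul_pow]; norm_num

theorem nonempty_effectiveContraction {D : ExtendedIFS X} {Q : ℕ → X} (h : IsDigitSpace D)
    (computable_digit : ∀ d, IsComputableMap Q Q (D.digit d)) :
    Nonempty (EffectiveContraction D Q) := by
  have := h.compact
  obtain ⟨K, K_nonneg, K_lt_one, dist_digit_le⟩ := exists_contraction_factor h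
  obtain ⟨B, dist_le⟩ := Metric.isBounded_iff.1 (isCompact_univ (X := X)).isBounded
  obtain ⟨depth, computable_depth, pow_mul_lt⟩ := exists_computable_pow_mul_lt B K_nonneg K_lt_one
  choose approx computable_approx dist_approx_lt using fun d =>
    (computable_digit d).exists_approx
  exact ⟨{
    K, K_nonneg, K_lt_one, dist_digit_le, B
    dist_le := fun x y => dist_le (Set.mem_univ x) (Set.mem_univ y)
    depth, computable_depth, pow_mul_lt, approx, dist_approx_lt
    computable_approx := computable_fin_apply
      (fun d => (computable_approx d).comp Computable.snd) Computable.fst }⟩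

end Contraction

section Inversion

variable {X : Type*} [MetricSpace X]

/-- What the proof uses of decidability, well-covering and approximable choice: a Lebesgue number
`2⁻ˡᵉᵇ` of the covering by the ranges of the digits together with a digit `sel u` whose range
contains the ball around the basic point `Q u`, and right inverses `sec d` of the digits with a
common modulus of continuity `om` and with approximations `choice d` at basic points. -/
structure EffectiveInversion (D : ExtendedIFS X) (Q : ℕ → X) where
  leb : ℕ
  sel : ℕ → Fin D.size
  computable_sel : Computable sel
  ball_sel_subset : ∀ u, Metric.ball (Q u) ((1 / 2 : ℝ) ^ leb) ⊆ Set.range (D.digit (sel u))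
  sec : (d : Fin D.size) → X → Fin (D.ar d) → X
  digit_sec : ∀ d x, x ∈ interior (Set.range (D.digit d)) → D.digit d (sec d x) = x
  om : ℕ → ℕ
  computable_om : Computable om
  le_om : ∀ k, k ≤ om k
  leb_add_two_le_om : ∀ k, leb + 2 ≤ om k
  dist_sec_lt : ∀ d k x x', x ∈ interior (Set.range (D.digit d)) →
    x' ∈ interior (Set.range (D.digit d)) → dist x x' < (1 / 2 : ℝ) ^ om k →
    dist (sec d x) (sec d x') < (1 / 2 : ℝ) ^ k
  choice : Fin D.size → ℕ × ℕ → List ℕ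
  computable_choice : Computable fun p : Fin D.size × ℕ × ℕ => choice p.1 p.2
  length_choice : ∀ d p, (choice d p).length = D.ar d
  dist_sec_choice_lt : ∀ d k u, Metric.ball (Q u) ((1 / 2 : ℝ) ^ (leb + 1)) ⊆
    Set.range (D.digit d) →
    dist (sec d (Q u)) (tuple Q (choice d (k, u)) (D.ar d)) < (1 / 2 : ℝ) ^ k

theorem ball_subset_interior {x : X} {r : ℝ} {s : Set X} (h : Metric.ball x r ⊆ s) :
    Metric.ball x r ⊆ interior s :=
  interior_maximal h Metric.isOpen_ball

theorem mem_interior_of_ball_half_pow_subset {x : X} {k : ℕ} {s : Set X}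
    (h : Metric.ball x ((1 / 2 : ℝ) ^ k) ⊆ s) : x ∈ interior s :=
  ball_subset_interior h (Metric.mem_ball_self (by positivity))

theorem exists_lebesgue_exponent [CompactSpace X] {D : ExtendedIFS X} (h : IsWellCovering D) :
    ∃ l : ℕ, ∀ x : X, ∃ d, Metric.ball x ((1 / 2 : ℝ) ^ l) ⊆ Set.range (D.digit d) := by
  obtain ⟨δ, δ_pos, hδ⟩ := lebesgue_number_lemma_of_metric (s := (Set.univ : Set X)) isCompact_univ
    (c := fun d => interior (Set.range (D.digit d))) (fun _ => isOpen_interior)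
    (fun x _ => Set.mem_iUnion.2 (h x))
  obtain ⟨l, hl⟩ := exists_pow_lt_of_lt_one δ_pos one_half_lt_one
  refine ⟨l, fun x => ?_⟩
  obtain ⟨d, hd⟩ := hδ x (Set.mem_univ x)
  exact ⟨d, (Metric.ball_subset_ball hl.le).trans (hd.trans interior_subset)⟩

theorem exists_computable_selector {α β : Type*} [Primcodable α] [Primcodable β]
    {p : α → β → Prop} (hp : ComputablePred fun q : α × β => p q.1 q.2) (h : ∀ a, ∃ b, p a b) :
    ∃ s : α → β, Computable s ∧ ∀ a, p a (s a) := by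
  obtain ⟨test, computable_test, p_eq⟩ := ComputablePred.computable_iff.1 hp
  have test_iff (q : α × β) : test q = true ↔ p q.1 q.2 := (congrFun p_eq q).to_iff.symm
  let search (a : α) (n : ℕ) : Option β :=
    (decode n).elim none fun b => cond (test (a, b)) (some b) none
  have computable_search : Computable fun q : α × ℕ => search q.1 q.2 :=
    computable_optionElim (Computable.decode.comp Computable.snd) (Computable.const none)
      (Computable.cond (by fun_prop) (Computable.option_some.comp Computable.snd)
        (Computable.const none))
  have holds {a : α} {n : ℕ} {b : β} (hb : b ∈ search a n) : p a b := by
    cases hc : (decode n : Option β) with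
    | none => simp [search, hc] at hb
    | some c =>
      cases ht : test (a, c) with
      | false => simp [search, hc, ht] at hb
      | true =>
        obtain rfl : c = b := by simpa [search, hc, ht] using hb
        exact (test_iff _).1 ht
  have dom (a : α) : (Nat.rfindOpt (search a)).Dom := by
    obtain ⟨b, hb⟩ := h a
    exact Nat.rfindOpt_dom.2 ⟨encode b, b, by simp [search, (test_iff (a, b)).2 hb]⟩
  refine ⟨fun a => (Nat.rfindOpt (search a)).get (dom a),
    (Partrec.rfindOpt computable_search).of_eq_tot fun a => Part.get_mem _, fun a => ?_⟩
  obtain ⟨n, hn⟩ := Nat.rfindOpt_spec (Part.get_mem (dom a))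
  exact holds hn

theorem exists_computable_eq_of_mem {α σ : Type*} [Primcodable α] [Primcodable σ] [Inhabited σ]
    {p : α → Prop} (hp : ComputablePred p) {f : α →. σ} (hf : Partrec f) {v : α → σ}
    (h : ∀ a, p a → v a ∈ f a) : ∃ g : α → σ, Computable g ∧ ∀ a, p a → g a = v a := by
  obtain ⟨_, computable_p⟩ := hp
  refine ⟨fun a => if p a then v a else default, Partrec.of_eq_tot
    (Partrec.cond computable_p hf (Computable.const default).partrec) fun a => ?_,
    fun a ha => if_pos ha⟩
  by_cases ha : p a
  · simpa [ha] using h a ha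
  · simp [ha]

theorem exists_computable_upper_bound {n : ℕ} {f : Fin n → ℕ → ℕ} (hf : ∀ i, Computable (f i)) :
    ∃ g : ℕ → ℕ, Computable g ∧ ∀ i k, f i k ≤ g k := by
  induction n with
  | zero => exact ⟨fun _ => 0, by fun_prop, fun i => i.elim0⟩
  | succ n ih =>
    obtain ⟨g, computable_g, le_g⟩ := ih fun i => hf i.castSucc
    have computable_last := hf (Fin.last n)
    refine ⟨fun k => g k + f (Fin.last n) k, by fun_prop, fun i k => ?_⟩
    induction i using Fin.lastCases with
    | last => exact Nat.le_add_left _ _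
    | cast i => exact (le_g i k).trans (Nat.le_add_right _ _)

/-- The conditions of approximable choice on a single map `φ`. -/
structure IsApproximateSection (Q : ℕ → X) {n : ℕ} (φ : (Fin n → X) → X)
    (v : ℕ × ℕ → ℕ → Fin n → ℕ) (t : ℕ × ℕ → ℕ × ℕ) : Prop where
  dist_lt_max : ∀ θ u, Q u ∈ interior (Set.range φ) → ∀ θ₁,
    dist (fun k => Q (v θ u k)) (fun k => Q (v θ₁ u k)) < max (posRat θ) (posRat θ₁)
  dist_lt : ∀ θ u u', Q u ∈ interior (Set.range φ) → Q u' ∈ interior (Set.range φ) →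
    dist (Q u) (Q u') < posRat (t θ) →
    dist (fun k => Q (v θ u k)) (fun k => Q (v θ u' k)) < posRat θ
  exists_eq : ∀ θ u, Q u ∈ interior (Set.range φ) →
    ∃ y : Fin n → X, φ y = Q u ∧ dist y (fun k => Q (v θ u k)) < posRat θ

section Construction

variable {Q : ℕ → X} {n : ℕ} {φ : (Fin n → X) → X} {v : ℕ × ℕ → ℕ → Fin n → ℕ}
  {t : ℕ × ℕ → ℕ × ℕ}

open Filter Topology in
/-- By compactness the approximations at basic points near `x` accumulate at some `y`. -/
theorem IsApproximateSection.exists_section [CompactSpace X] (h : IsApproximateSection Q φ v t)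
    (hQ : DenseRange Q) (hφ : Continuous φ) {x : X} (hx : x ∈ interior (Set.range φ)) :
    ∃ y : Fin n → X, φ y = x ∧ ∀ θ u, Q u ∈ interior (Set.range φ) →
      dist x (Q u) < posRat (t θ) → dist y (fun k => Q (v θ u k)) ≤ 2 * posRat θ := by
  obtain ⟨_, mem_inter, tendsto_x⟩ :=
    mem_closure_iff_seq_limit.1 (hQ.open_subset_closure_inter isOpen_interior hx)
  choose mem_interior u hu using mem_inter
  obtain rfl : (fun j => Q (u j)) = _ := funext hu
  have tendsto_half_pow : Tendsto (fun j : ℕ => (1 / 2 : ℝ) ^ j) atTop (𝓝 0) :=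
    tendsto_pow_atTop_nhds_zero_of_lt_one (by norm_num) (by norm_num)
  let z : ℕ → Fin n → X := fun j k => Q (v (dyadic j) (u j) k)
  obtain ⟨y, ψ, ψ_mono, tendsto_y⟩ := CompactSpace.tendsto_subseq z
  replace tendsto_x := tendsto_x.comp ψ_mono.tendsto_atTop
  replace tendsto_half_pow := tendsto_half_pow.comp ψ_mono.tendsto_atTop
  refine ⟨y, ?_, fun θ w hw hxw => ?_⟩
  · choose y' φ_y' dist_y' using fun j => h.exists_eq (dyadic j) (u j) (mem_interior j)
    simp only [posRat_dyadic] at dist_y'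
    have tendsto_y' : Tendsto (y' ∘ ψ) atTop (𝓝 y) := (tendsto_iff_of_dist (squeeze_zero
      (fun _ => dist_nonneg) (fun j => (dist_y' (ψ j)).le) tendsto_half_pow)).2 tendsto_y
    exact tendsto_nhds_unique ((hφ.tendsto y).comp tendsto_y')
      (tendsto_x.congr fun j => (φ_y' (ψ j)).symm)
  · refine le_of_tendsto (tendsto_y.dist tendsto_const_nhds) ?_
    filter_upwards [tendsto_half_pow.eventually (gt_mem_nhds (posRat_pos θ)),
      (tendsto_x.dist tendsto_const_nhds).eventually (gt_mem_nhds hxw)] with j precision near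
    simp only [Function.comp_apply] at precision near
    have dist_precision := h.dist_lt_max (dyadic (ψ j)) (u (ψ j)) (mem_interior _) θ
    rw [posRat_dyadic, max_eq_right precision.le] at dist_precision
    have dist_point := h.dist_lt θ _ _ (mem_interior _) hw near
    calc dist (z (ψ j)) (fun k => Q (v θ w k))
        ≤ dist (z (ψ j)) (fun k => Q (v θ (u (ψ j)) k)) + dist _ _ := dist_triangle _ _ _
      _ ≤ 2 * posRat θ := by linarith

theorem IsApproximateSection.exists_section_map [CompactSpace X]
    (h : IsApproximateSection Q φ v t) (hQ : DenseRange Q) (hφ : Continuous φ) :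
    ∃ s : X → Fin n → X, (∀ x ∈ interior (Set.range φ), φ (s x) = x) ∧
      (∀ θ u, Q u ∈ interior (Set.range φ) →
        dist (s (Q u)) (fun k => Q (v θ u k)) ≤ 2 * posRat θ) ∧
      ∀ θ, ∀ x ∈ interior (Set.range φ), ∀ x' ∈ interior (Set.range φ),
        dist x x' < posRat (t θ) → dist (s x) (s x') ≤ 4 * posRat θ := by
  have exists_value (x : X) : ∃ y : Fin n → X, x ∈ interior (Set.range φ) → φ y = x ∧
      ∀ θ u, Q u ∈ interior (Set.range φ) → dist x (Q u) < posRat (t θ) →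
        dist y (fun k => Q (v θ u k)) ≤ 2 * posRat θ := by
    by_cases hx : x ∈ interior (Set.range φ)
    · obtain ⟨y, hy⟩ := h.exists_section hQ hφ hx
      exact ⟨y, fun _ => hy⟩
    · exact ⟨fun _ => x, fun h => absurd h hx⟩
  choose s hs using exists_value
  refine ⟨s, fun x hx => (hs x hx).1, fun θ u hu => ?_, fun θ x hx x' hx' hxx' => ?_⟩
  · exact (hs _ hu).2 θ u hu ((dist_self (Q u)).trans_lt (posRat_pos _))
  · obtain ⟨_, ⟨mem_interior, near⟩, u, rfl⟩ := mem_closure_iff_nhds.1 (hQ x)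
      (interior (Set.range φ) ∩ Metric.ball x (posRat (t θ) - dist x x'))
      (Filter.inter_mem (isOpen_interior.mem_nhds hx)
        (Metric.ball_mem_nhds x (sub_pos.2 hxx')))
    rw [Metric.mem_ball'] at near
    have dist_s := (hs x hx).2 θ u mem_interior (by linarith [dist_nonneg (x := x) (y := x')])
    have dist_s' := (hs x' hx').2 θ u mem_interior (by linarith [dist_triangle_left x' (Q u) x])
    linarith [dist_triangle_right (s x) (s x') (fun k => Q (v θ u k))]

variable {D : ExtendedIFS X}

theorem exists_effective_sections [CompactSpace X] (hQ : DenseRange Q)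
    (h : HasApproximableChoice D Q) (b : ℕ) :
    ∃ (sec : (d : Fin D.size) → X → Fin (D.ar d) → X) (om : ℕ → ℕ)
      (v : (d : Fin D.size) → ℕ × ℕ → Fin (D.ar d) → ℕ)
      (p : (d : Fin D.size) → ℕ × ℕ →. (Fin (D.ar d) → ℕ)),
      (∀ d, ∀ x ∈ interior (Set.range (D.digit d)), D.digit d (sec d x) = x) ∧
      (Computable om ∧ ∀ k, k ≤ om k ∧ b ≤ om k) ∧
      (∀ d k x x', x ∈ interior (Set.range (D.digit d)) → x' ∈ interior (Set.range (D.digit d)) →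
        dist x x' < (1 / 2 : ℝ) ^ om k → dist (sec d x) (sec d x') < (1 / 2 : ℝ) ^ k) ∧
      (∀ d, Partrec (p d)) ∧
      ∀ d k u, Q u ∈ interior (Set.range (D.digit d)) → v d (k, u) ∈ p d (k, u) ∧
        dist (sec d (Q u)) (fun j => Q (v d (k, u) j)) < (1 / 2 : ℝ) ^ k := by
  choose v p t partrec_p computable_t mem_p conditions using h
  have section_d (d) : IsApproximateSection Q (D.digit d) (v d) (t d) :=
    ⟨fun θ => (conditions d θ).1, fun θ => (conditions d θ).2.1, fun θ => (conditions d θ).2.2⟩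
  choose sec digit_sec dist_sec_basic dist_sec using fun d =>
    (section_d d).exists_section_map hQ (D.continuous_digit d)
  have computable_modulus (d) : Computable fun k => (t d (dyadic (k + 3))).2 := by
    have := computable_t d
    fun_prop
  obtain ⟨g, computable_g, le_g⟩ := exists_computable_upper_bound computable_modulus
  refine ⟨sec, fun k => k + b + g k, fun d q => v d (dyadic (q.1 + 2)) q.2,
    fun d q => p d (dyadic (q.1 + 2), q.2), digit_sec, ⟨by fun_prop, fun k => by lia⟩,
    fun d k x x' hx hx' hxx' => ?_, fun d => (partrec_p d).comp (by fun_prop),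
    fun d k u hu => ⟨mem_p d _ u hu, ?_⟩⟩
  · have near : dist x x' < posRat (t d (dyadic (k + 3))) := hxx'.trans_le
      ((half_pow_anti (by linarith [le_g d k])).trans (half_pow_le_posRat _))
    calc dist (sec d x) (sec d x') ≤ 4 * posRat (dyadic (k + 3)) := dist_sec d _ x hx x' hx' near
      _ = (1 / 2 : ℝ) ^ k / 2 := by rw [posRat_dyadic]; ring
      _ < (1 / 2 : ℝ) ^ k := half_lt_self (by positivity)
  · calc dist (sec d (Q u)) _ ≤ 2 * posRat (dyadic (k + 2)) := dist_sec_basic d _ u hu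
      _ = (1 / 2 : ℝ) ^ k / 2 := by rw [posRat_dyadic]; ring
      _ < (1 / 2 : ℝ) ^ k := half_lt_self (by positivity)

theorem IsDecidable.computablePred_ball (h : IsDecidable D Q) (k : ℕ) :
    ComputablePred fun q : ℕ × Fin D.size =>
      Metric.ball (Q q.1) ((1 / 2 : ℝ) ^ k) ⊆ Set.range (D.digit q.2) :=
  ComputablePred.computable_of_manyOneReducible
    ⟨fun q => (q.1, dyadic k, q.2), by fun_prop, fun q => by rw [posRat_dyadic]⟩ h

theorem nonempty_effectiveInversion [CompactSpace X] (hQ : DenseRange Q) (hdec : IsDecidable D Q)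
    (hwell : IsWellCovering D) (hchoice : HasApproximableChoice D Q) :
    Nonempty (EffectiveInversion D Q) := by
  obtain ⟨leb, exists_ball_subset⟩ := exists_lebesgue_exponent hwell
  obtain ⟨sel, computable_sel, ball_sel_subset⟩ :=
    exists_computable_selector (hdec.computablePred_ball leb) fun u => exists_ball_subset (Q u)
  obtain ⟨sec, om, v, p, digit_sec, ⟨computable_om, le_om⟩, dist_sec_lt, partrec_p, v_spec⟩ :=
    exists_effective_sections hQ hchoice (leb + 2)
  have computablePred_ball (d) : ComputablePred fun q : ℕ × ℕ =>
      Metric.ball (Q q.2) ((1 / 2 : ℝ) ^ (leb + 1)) ⊆ Set.range (D.digit d) :=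
    ComputablePred.computable_of_manyOneReducible
      ⟨fun q => (q.2, d), by fun_prop, fun _ => Iff.rfl⟩ (hdec.computablePred_ball (leb + 1))
  choose g computable_g g_eq using fun d => exists_computable_eq_of_mem (computablePred_ball d)
    (partrec_p d) fun q hq => (v_spec d q.1 q.2 (mem_interior_of_ball_half_pow_subset hq)).1
  exact ⟨{
    leb, sel, computable_sel, ball_sel_subset, sec, digit_sec, om, computable_om
    le_om := fun k => (le_om k).1
    leb_add_two_le_om := fun k => (le_om k).2
    dist_sec_lt
    choice := fun d q => List.ofFn (g d q)
    computable_choice := computable_fin_apply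
      (fun d => (computable_ofFn _).comp ((computable_g d).comp Computable.snd)) Computable.fst
    length_choice := fun d q => List.length_ofFn
    dist_sec_choice_lt := fun d k u hu => by
      rw [tuple_ofFn, g_eq d (k, u) hu]
      exact (v_spec d k u (mem_interior_of_ball_half_pow_subset hu)).2 }⟩

end Construction

namespace EffectiveInversion

variable {D : ExtendedIFS X} {Q : ℕ → X} (I : EffectiveInversion D Q)

theorem mem_interior_of_dist_lt {d : Fin D.size} {l u : ℕ} {x : X} (hl : I.leb + 1 ≤ l)
    (hu : Metric.ball (Q u) ((1 / 2 : ℝ) ^ (I.leb + 1)) ⊆ Set.range (D.digit d))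
    (hx : dist x (Q u) < (1 / 2 : ℝ) ^ l) : x ∈ interior (Set.range (D.digit d)) :=
  ball_subset_interior hu (Metric.mem_ball.2 (hx.trans_le (half_pow_anti hl)))

theorem dist_sec_choice_lt_of_dist_lt {d : Fin D.size} {k l u : ℕ} {x : X}
    (hl : I.om (k + 1) ≤ l)
    (hu : Metric.ball (Q u) ((1 / 2 : ℝ) ^ (I.leb + 1)) ⊆ Set.range (D.digit d))
    (hx : dist x (Q u) < (1 / 2 : ℝ) ^ l) :
    dist (I.sec d x) (tuple Q (I.choice d (l, u)) (D.ar d)) < (1 / 2 : ℝ) ^ k := by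
  have mem_x := I.mem_interior_of_dist_lt (by linarith [I.leb_add_two_le_om (k + 1)]) hu hx
  have dist_sec := I.dist_sec_lt d (k + 1) x (Q u) mem_x
    (mem_interior_of_ball_half_pow_subset hu) (hx.trans_le (half_pow_anti hl))
  have dist_choice := (I.dist_sec_choice_lt d l u hu).trans_le
    (half_pow_anti ((I.le_om (k + 1)).trans hl))
  rw [half_pow_succ] at dist_sec dist_choice
  linarith [dist_triangle (I.sec d x) (I.sec d (Q u)) (tuple Q (I.choice d (l, u)) (D.ar d))]

end EffectiveInversion

end Inversion

/-! ### From realisers to algorithms -/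

section Plug

/-- Replace the entry at position `i` of a list by the entries of `v`, which corresponds to
inverting `plug` in terms of lists of indices. -/
def plugList {α : Type*} (l : List α) (i : ℕ) (v : List α) : List α :=
  l.take i ++ (v ++ l.drop (i + 1))

/-- Replace the entry at position `i` of a tuple by the entries of `y`. This is a right inverse of
`plug` where `y` is a preimage of that entry. -/
def unplug {X : Type*} {n m : ℕ} (x : Fin m → X) (i : Fin m) (y : Fin n → X) :
    Fin (n + m - 1) → X := fun j =>
  if h₁ : (j : ℕ) < i then x ⟨j, by lia⟩
  else if h₂ : (j : ℕ) < i + n then y ⟨j - i, by lia⟩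
  else x ⟨j + 1 - n, by lia⟩

@[fun_prop]
theorem computable_plugList {α β : Type*} [Primcodable α] [Primcodable β] {f g : α → List β}
    {i : α → ℕ} (hf : Computable f) (hi : Computable i) (hg : Computable g) :
    Computable fun a => plugList (f a) (i a) (g a) := by
  unfold plugList
  fun_prop

theorem length_plugList {α : Type*} {l v : List α} {i : ℕ} (h : i < l.length) :
    (plugList l i v).length = v.length + l.length - 1 := by
  simp only [plugList, List.length_append, List.length_take, List.length_drop]
  lia

theorem getD_plugList {α : Type*} {l v : List α} {i : ℕ} (h : i < l.length) (j : ℕ) (a : α) :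
    (plugList l i v).getD j a = if j < i then l.getD j a
      else if j < i + v.length then v.getD (j - i) a else l.getD (j + 1 - v.length) a := by
  simp only [plugList, List.getD_eq_getElem?_getD, List.getElem?_append, List.length_take,
    min_eq_left h.le, List.getElem?_drop]
  split_ifs
  · simp [*]
  · rfl
  · lia
  · lia
  · congr 2
    lia

theorem plug_unplug {X : Type*} {n m : ℕ} (φ : (Fin n → X) → X) (x : Fin m → X) (i : Fin m)
    (y : Fin n → X) (h : φ y = x i) : plug φ i (unplug x i y) = x := by
  funext j
  rcases lt_trichotomy (j : ℕ) i with lt | eq | gt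
  · simp [plug, unplug, lt]
  · obtain rfl : j = i := Fin.ext eq
    simp [plug, unplug, h]
  · have not_lt : ¬ (j : ℕ) + n - 1 < i := by lia
    have not_lt_add : ¬ (j : ℕ) + n - 1 < i + n := by lia
    have shift_back : (j : ℕ) + n - 1 + 1 - n = j := by lia
    simp [plug, unplug, gt.not_gt, gt.ne', not_lt, not_lt_add, shift_back]

theorem dist_unplug_lt {X : Type*} [MetricSpace X] {n m : ℕ} {x x' : Fin m → X} (i : Fin m)
    {y y' : Fin n → X} {r : ℝ} (hr : 0 < r) (hx : dist x x' < r) (hy : dist y y' < r) :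
    dist (unplug x i y) (unplug x' i y') < r := by
  rw [dist_pi_lt_iff hr] at hx hy ⊢
  intro j
  unfold unplug
  split_ifs
  exacts [hx _, hy _, hx _]

theorem tuple_plugList {X : Type*} (Q : ℕ → X) {l v : List ℕ} {n m : ℕ} (hl : l.length = m)
    (hv : v.length = n) (i : Fin m) :
    tuple Q (plugList l i v) (n + m - 1) = unplug (tuple Q l m) i (tuple Q v n) := by
  funext j
  have hi : (i : ℕ) < l.length := hl ▸ i.2
  simp only [tuple, unplug, getD_plugList hi, hv]
  split_ifs <;> rfl

theorem EffectiveInversion.exists_plug_eq_dist_lt {X : Type*} [MetricSpace X] {D : ExtendedIFS X}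
    {Q : ℕ → X} (I : EffectiveInversion D Q) {d : Fin D.size} {k K m : ℕ} {l : List ℕ}
    (hl : l.length = m) (i : Fin m) (hK : I.om (k + 1) ≤ K)
    (hd : Metric.ball (Q (l.getD i 0)) ((1 / 2 : ℝ) ^ (I.leb + 1)) ⊆ Set.range (D.digit d))
    {x : Fin m → X} (hx : dist x (tuple Q l m) < (1 / 2 : ℝ) ^ K) :
    ∃ z : Fin (D.ar d + m - 1) → X, plug (D.digit d) i z = x ∧
      dist z (tuple Q (plugList l i (I.choice d (K, l.getD i 0))) (D.ar d + m - 1)) <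
        (1 / 2 : ℝ) ^ k := by
  have dist_xi : dist (x i) (Q (l.getD i 0)) < (1 / 2 : ℝ) ^ K :=
    (dist_le_pi_dist x (tuple Q l m) i).trans_lt hx
  have mem_xi := I.mem_interior_of_dist_lt (by linarith [I.leb_add_two_le_om (k + 1)]) hd dist_xi
  refine ⟨unplug x i (I.sec d (x i)), plug_unplug _ x i _ (I.digit_sec d _ mem_xi), ?_⟩
  rw [tuple_plugList Q hl (I.length_choice d _)]
  exact dist_unplug_lt i (by positivity)
    (hx.trans_le (half_pow_anti (by linarith [I.le_om (k + 1)])))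
    (I.dist_sec_choice_lt_of_dist_lt hK hd dist_xi)

end Plug

section Evaluation

variable {X : Type*} [MetricSpace X] {Y : Type*} [MetricSpace Y]
  {D : ExtendedIFS X} {E : ExtendedIFS Y} {QX : ℕ → X} {QY : ℕ → Y}

/-- The immediate successors of a node, where nodes are paired with the number of writing nodes
that an evaluation at them passes. -/
def successors (D : ExtendedIFS X) (L : List ℕ → Option (Label E)) (p : List ℕ × ℕ) :
    List (List ℕ × ℕ) :=
  if 0 < p.2 then (L p.1).elim [] (Sum.elim
    (fun e => List.ofFn fun j : Fin (E.ar e) => (p.1 ++ [(j : ℕ)], p.2 - 1))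
    fun _ => List.ofFn fun d : Fin D.size => (p.1 ++ [(d : ℕ)], p.2))
  else []

/-- The precision with which the arguments have to be known at a node, given the precisions for
its immediate successors. -/
def precision (I : EffectiveInversion D QX) (r : List ℕ) : ℕ :=
  (r.map fun k => I.om (k + 1)).foldr max 0

/-- The evaluations to which the evaluation at the node `p` refers. The arguments of the map are
given by the indices `q.1`, the digits of `Y` are evaluated with precision `q.2`, and `k` is the
precision belonging to the node. -/
def evalCalls (I : EffectiveInversion D QX) (L : List ℕ → Option (Label E)) (p q : List ℕ × ℕ)
    (k : ℕ) : List ((List ℕ × ℕ) × (List ℕ × ℕ)) :=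
  if 0 < p.2 then (L p.1).elim [] (Sum.elim
    (fun _ => (successors D L p).map fun p' => (p', q))
    fun i =>
      let u := q.1.getD i 0
      [((p.1 ++ [(I.sel u : ℕ)], p.2), (plugList q.1 i (I.choice (I.sel u) (k, u)), q.2))])
  else []

/-- The value at a node with the given label from the values to which the evaluation refers. -/
def evalCombine (C : EffectiveContraction E QY) (o : Option (Label E)) (N : ℕ) (r : List ℕ) : ℕ :=
  o.elim 0 (Sum.elim (fun e => C.approx e (r, N)) fun _ => r.getD 0 0)

variable {L : List ℕ → Option (Label E)}

theorem computable_successors (hL : Computable L) : Computable (successors D L) := by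
  have computable_label : Computable fun p : List ℕ × ℕ => L p.1 := by fun_prop
  have computable_write : Computable fun q : ((List ℕ × ℕ) × Label E) × Fin E.size =>
      List.ofFn fun j : Fin (E.ar q.2) => (q.1.1.1 ++ [(j : ℕ)], q.1.1.2 - 1) :=
    computable_fin_apply (f := fun e (q : ((List ℕ × ℕ) × Label E) × Fin E.size) =>
        List.ofFn fun j : Fin (E.ar e) => (q.1.1.1 ++ [(j : ℕ)], q.1.1.2 - 1))
      (fun e => Computable.list_ofFn fun j => by fun_prop) Computable.snd
  have computable_read : Computable fun q : ((List ℕ × ℕ) × Label E) × ℕ =>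
      List.ofFn fun d : Fin D.size => (q.1.1.1 ++ [(d : ℕ)], q.1.1.2) :=
    Computable.list_ofFn fun d => by fun_prop
  exact computable_ite_lt (Computable.const 0) Computable.snd
    (computable_optionElim computable_label (Computable.const [])
      (computable_sumElim Computable.snd computable_write computable_read)) (Computable.const [])

theorem computable_precision (I : EffectiveInversion D QX) : Computable (precision I) := by
  have computable_max : Computable fun l : List ℕ => l.foldr max 0 :=
    (Primrec.list_foldr Primrec.id (Primrec.const 0)
      (Primrec.nat_max.comp (Primrec.fst.comp Primrec.snd)
        (Primrec.snd.comp Primrec.snd)).to₂).to_comp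
  have computable_om := I.computable_om
  unfold precision
  fun_prop

theorem computable_evalCalls (I : EffectiveInversion D QX) (hL : Computable L) :
    Computable fun q : ((List ℕ × ℕ) × (List ℕ × ℕ)) × ℕ => evalCalls I L q.1.1 q.1.2 q.2 := by
  have computable_successors := computable_successors (D := D) hL
  have computable_sel := I.computable_sel
  have computable_choice := I.computable_choice
  unfold evalCalls
  fun_prop

theorem computable_evalCombine (C : EffectiveContraction E QY) :
    Computable fun p : Option (Label E) × ℕ × List ℕ => evalCombine C p.1 p.2.1 p.2.2 := by
  have computable_approx := C.computable_approx
  unfold evalCombine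
  fun_prop

/-- `M` and `V` are procedures computing the precisions and the values at the nodes of the tree
with labelling `L`, by recursion according to `successors`, respectively `evalCalls`. -/
structure IsEvaluator (I : EffectiveInversion D QX) (C : EffectiveContraction E QY)
    (L : List ℕ → Option (Label E)) (M : List ℕ × ℕ →. ℕ)
    (V : (List ℕ × ℕ) × (List ℕ × ℕ) →. ℕ) : Prop where
  precision_mem : ∀ {p r}, List.Forall₂ (fun p' k => k ∈ M p') (successors D L p) r →
    precision I r ∈ M p
  evalCombine_mem : ∀ {p q k r}, k ∈ M p →
    List.Forall₂ (fun p' v => v ∈ V p') (evalCalls I L p q k) r →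
    evalCombine C (L p.1) q.2 r ∈ V (p, q)

theorem exists_isEvaluator (I : EffectiveInversion D QX) (C : EffectiveContraction E QY)
    (hL : Computable L) : ∃ M V, Partrec M ∧ Partrec V ∧ IsEvaluator I C L M V := by
  have computable_evalCalls := computable_evalCalls I hL
  have computable_precision := computable_precision I
  have computable_evalCombine := computable_evalCombine C
  obtain ⟨M, partrec_M, mem_M⟩ := exists_partrec_rec (combine := fun _ => precision I)
    (computable_successors (D := D) hL).partrec (by fun_prop)
  obtain ⟨V, partrec_V, mem_V⟩ := exists_partrec_rec
    (calls := fun p : (List ℕ × ℕ) × (List ℕ × ℕ) => (M p.1).map (evalCalls I L p.1 p.2))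
    (combine := fun p => evalCombine C (L p.1.1) p.2.2)
    (Partrec.map (partrec_M.comp Computable.fst) computable_evalCalls.to₂)
    (by fun_prop)
  exact ⟨M, V, partrec_M, partrec_V, mem_M _ _ _ (Part.mem_some _),
    fun hk => mem_V _ _ _ (Part.mem_map _ hk)⟩

/-- At the node `p` the procedures `M` and `V` terminate and evaluate `f`. The error consists of
`C.K ^ p.2 * C.B`, since the evaluation is broken off after `p.2` writing nodes, and of the
accumulated errors in the evaluation of the digits of `Y`. -/
def EvaluatesAt (QX : ℕ → X) (C : EffectiveContraction E QY) (M : List ℕ × ℕ →. ℕ)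
    (V : (List ℕ × ℕ) × (List ℕ × ℕ) →. ℕ) (p : List ℕ × ℕ) (f : Maps X Y) : Prop :=
  ∃ k ∈ M p, ∀ l N, l.length = f.1 → ∃ v ∈ V (p, (l, N)), ∀ x,
    dist x (tuple QX l f.1) < (1 / 2 : ℝ) ^ k →
    dist (f.2 x) (QY v) ≤ C.K ^ p.2 * C.B + (1 - C.K)⁻¹ * (1 / 2 : ℝ) ^ N

variable {I : EffectiveInversion D QX} {C : EffectiveContraction E QY} {M : List ℕ × ℕ →. ℕ}
  {V : (List ℕ × ℕ) × (List ℕ × ℕ) →. ℕ}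

theorem forall₂_ofFn {α β : Type*} {R : α → β → Prop} {n : ℕ} {f : Fin n → α} {g : Fin n → β}
    (h : ∀ j, R (f j) (g j)) : List.Forall₂ R (List.ofFn f) (List.ofFn g) := by
  rw [List.forall₂_iff_get]
  exact ⟨by simp, fun i _ _ => by simpa using h _⟩

theorem le_precision (I : EffectiveInversion D QX) {r : List ℕ} {k : ℕ} (hk : k ∈ r) :
    I.om (k + 1) ≤ precision I r :=
  List.le_max_of_le (List.mem_map_of_mem hk) le_rfl

theorem inv_one_sub_pos (C : EffectiveContraction E QY) : 0 < (1 - C.K)⁻¹ :=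
  inv_pos.2 (sub_pos.2 C.K_lt_one)

theorem evaluatesAt_zero (h : IsEvaluator I C L M V) (s : List ℕ) (f : Maps X Y) :
    EvaluatesAt QX C M V (s, 0) f := by
  have mem_M : precision I [] ∈ M (s, 0) := h.precision_mem (by simp [successors])
  refine ⟨_, mem_M, fun l N _ => ⟨_, h.evalCombine_mem (r := []) mem_M (by simp [evalCalls]),
    fun x _ => ?_⟩⟩
  have error_pos : 0 < (1 - C.K)⁻¹ * (1 / 2 : ℝ) ^ N := mul_pos (inv_one_sub_pos C) (by positivity)
  rw [pow_zero, one_mul]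
  linarith [C.dist_le (f.2 x) (QY (evalCombine C (L s) N []))]

theorem dist_digit_approx_le (C : EffectiveContraction E QY) (e : Fin E.size) {l : List ℕ}
    {N n : ℕ} {y : Fin (E.ar e) → Y} (hy : ∀ j : Fin (E.ar e),
      dist (y j) (QY (l.getD j 0)) ≤ C.K ^ n * C.B + (1 - C.K)⁻¹ * (1 / 2 : ℝ) ^ N) :
    dist (E.digit e y) (QY (C.approx e (l, N))) ≤
      C.K ^ (n + 1) * C.B + (1 - C.K)⁻¹ * (1 / 2 : ℝ) ^ N := by
  have : Nonempty (Fin (E.ar e)) := ⟨⟨0, E.ar_pos e⟩⟩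
  have one_sub_ne : 1 - C.K ≠ 0 := (sub_pos.2 C.K_lt_one).ne'
  calc dist (E.digit e y) (QY (C.approx e (l, N)))
      ≤ dist (E.digit e y) (E.digit e (tuple QY l (E.ar e))) +
          dist (E.digit e (tuple QY l (E.ar e))) (QY (C.approx e (l, N))) := dist_triangle ..
    _ ≤ C.K * dist y (tuple QY l (E.ar e)) + (1 / 2 : ℝ) ^ N :=
        add_le_add (C.dist_digit_le ..) (C.dist_approx_lt ..).le
    _ ≤ C.K * (C.K ^ n * C.B + (1 - C.K)⁻¹ * (1 / 2 : ℝ) ^ N) + (1 / 2 : ℝ) ^ N := by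
        gcongr
        exacts [C.K_nonneg, dist_pi_le_iff'.2 hy]
    _ = C.K ^ (n + 1) * C.B + (1 - C.K)⁻¹ * (1 / 2 : ℝ) ^ N := by
        field_simp
        ring

theorem evaluatesAt_write (h : IsEvaluator I C L M V) {s : List ℕ} {n : ℕ} {f : Maps X Y}
    {e : Fin E.size} (hL : L s = some (.inl e)) {g : Fin (E.ar e) → (Fin f.1 → X) → Y}
    (hg : ∀ j : Fin (E.ar e), EvaluatesAt QX C M V (s ++ [(j : ℕ)], n) ⟨f.1, g j⟩)
    (hf : f.2 = fun x => E.digit e fun j => g j x) : EvaluatesAt QX C M V (s, n + 1) f := by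
  choose k mem_M eval using hg
  have successors_eq : successors D L (s, n + 1) =
      List.ofFn fun j : Fin (E.ar e) => (s ++ [(j : ℕ)], n) := by simp [successors, hL]
  have precision_mem : precision I (List.ofFn k) ∈ M (s, n + 1) :=
    h.precision_mem (by rw [successors_eq]; exact forall₂_ofFn mem_M)
  refine ⟨_, precision_mem, fun l N hl => ?_⟩
  choose v mem_V dist_le using fun j => eval j l N hl
  have calls_eq : evalCalls I L (s, n + 1) (l, N) (precision I (List.ofFn k)) =
      List.ofFn fun j : Fin (E.ar e) => ((s ++ [(j : ℕ)], n), (l, N)) := by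
    simp [evalCalls, successors_eq, hL, List.map_ofFn, Function.comp_def]
  have value_mem := h.evalCombine_mem precision_mem (r := List.ofFn v)
    (by rw [calls_eq]; exact forall₂_ofFn mem_V)
  simp only [hL, evalCombine, Option.elim_some, Sum.elim_inl] at value_mem
  refine ⟨_, value_mem, fun x hx => ?_⟩
  rw [hf]
  refine dist_digit_approx_le C e fun j => ?_
  have le_precision : k j ≤ precision I (List.ofFn k) := by
    linarith [le_precision I (List.mem_ofFn.2 ⟨j, rfl⟩ : k j ∈ List.ofFn k), I.le_om (k j + 1)]
  simpa using dist_le j x (hx.trans_le (half_pow_anti le_precision))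

theorem evaluatesAt_read (h : IsEvaluator I C L M V) {s : List ℕ} {n : ℕ} {f : Maps X Y}
    {i : Fin f.1} (hL : L s = some (.inr (i : ℕ)))
    (hd : ∀ d : Fin D.size, EvaluatesAt QX C M V (s ++ [(d : ℕ)], n + 1)
      ⟨D.ar d + f.1 - 1, f.2 ∘ plug (D.digit d) i⟩) : EvaluatesAt QX C M V (s, n + 1) f := by
  choose k mem_M eval using hd
  have successors_eq : successors D L (s, n + 1) =
      List.ofFn fun d : Fin D.size => (s ++ [(d : ℕ)], n + 1) := by simp [successors, hL]
  have precision_mem : precision I (List.ofFn k) ∈ M (s, n + 1) :=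
    h.precision_mem (by rw [successors_eq]; exact forall₂_ofFn mem_M)
  refine ⟨_, precision_mem, fun l N hl => ?_⟩
  set K := precision I (List.ofFn k)
  set u := l.getD i 0
  set d := I.sel u
  obtain ⟨v, mem_V, dist_le⟩ := eval d (plugList l i (I.choice d (K, u))) N
    (by rw [length_plugList (by rw [hl]; exact i.2), I.length_choice, hl])
  have calls_eq : evalCalls I L (s, n + 1) (l, N) K =
      [((s ++ [(d : ℕ)], n + 1), (plugList l i (I.choice d (K, u)), N))] := by
    simp [evalCalls, hL, d, u]
  have value_mem := h.evalCombine_mem precision_mem (r := [v])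
    (by rw [calls_eq]; exact .cons mem_V .nil)
  simp only [hL, evalCombine, Option.elim_some, Sum.elim_inr, List.getD_cons_zero] at value_mem
  refine ⟨v, value_mem, fun x hx => ?_⟩
  obtain ⟨z, rfl, dist_z⟩ := I.exists_plug_eq_dist_lt (k := k d) hl i
    (le_precision I (List.mem_ofFn.2 ⟨d, rfl⟩))
    ((Metric.ball_subset_ball (half_pow_anti (Nat.le_succ _))).trans (I.ball_sel_subset u)) hx
  exact dist_le z dist_z

theorem evaluatesAt_of_realises (h : IsEvaluator I C L M V) (n : ℕ) {T : FTree D E}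
    {f : Maps X Y} (hT : Realises D E T f) {s : List ℕ} (hs : ∀ r, T.label r = L (s ++ r)) :
    EvaluatesAt QX C M V (s, n) f := by
  have root_label {T : FTree D E} {s : List ℕ} (hs : ∀ r, T.label r = L (s ++ r)) :
      L s = some T.root := by rw [← T.label_nil_eq, hs, List.append_nil]
  have subtree_label {T : FTree D E} {s : List ℕ} (hs : ∀ r, T.label r = L (s ++ r)) (j : ℕ)
      (r : List ℕ) : T.label (j :: r) = L (s ++ [j] ++ r) := by
    rw [hs, List.append_assoc, List.singleton_append]
  refine Realises.write_induction (P := fun n T f => ∀ s, (∀ r, T.label r = L (s ++ r)) →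
    EvaluatesAt QX C M V (s, n) f) ?_ ?_ ?_ n hT s hs
  · exact fun T f s _ => evaluatesAt_zero h s f
  · exact fun n T f e he g ih hf s hs => evaluatesAt_write h (he ▸ root_label hs)
      (fun j => ih j _ (subtree_label hs j)) hf
  · exact fun n T f i hi ih s hs => evaluatesAt_read h (hi ▸ root_label hs)
      fun d => ih d _ (subtree_label hs d)

theorem EffectiveContraction.exists_error_lt (C : EffectiveContraction E QY) : ∃ c : ℕ, ∀ k,
    C.K ^ C.depth (k + 1) * C.B + (1 - C.K)⁻¹ * (1 / 2 : ℝ) ^ (k + 1 + c) < (1 / 2 : ℝ) ^ k := by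
  obtain ⟨c, hc⟩ := pow_unbounded_of_one_lt (1 - C.K)⁻¹ one_lt_two
  refine ⟨c, fun k => ?_⟩
  have accumulated : (1 - C.K)⁻¹ * (1 / 2 : ℝ) ^ (k + 1 + c) ≤ (1 / 2 : ℝ) ^ (k + 1) :=
    calc (1 - C.K)⁻¹ * (1 / 2 : ℝ) ^ (k + 1 + c)
        ≤ 2 ^ c * (1 / 2 : ℝ) ^ (k + 1 + c) := by gcongr
      _ = (1 / 2 : ℝ) ^ (k + 1) := by
        rw [pow_add _ (k + 1) c, mul_left_comm, ← mul_pow]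
        norm_num
  linarith [C.pow_mul_lt (k + 1) _ le_rfl, half_pow_succ k]

theorem isComputableMap_of_realises (I : EffectiveInversion D QX) (C : EffectiveContraction E QY)
    (hQ : DenseRange QX) {T : FTree D E} (hT : T.IsComputable) {f : Maps X Y}
    (h : Realises D E T f) : IsComputableMap QX QY f.2 := by
  obtain ⟨M, V, partrec_M, partrec_V, evaluator⟩ := exists_isEvaluator I C hT
  obtain ⟨c, error_lt⟩ := C.exists_error_lt
  have computable_depth := C.computable_depth
  choose μ mem_M eval using fun k => evaluatesAt_of_realises (s := []) evaluator
    (C.depth (k + 1)) h fun _ => rfl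
  have computable_μ : Computable μ :=
    Partrec.of_eq_tot (partrec_M.comp (g := fun k => ([], C.depth (k + 1))) (by fun_prop)) mem_M
  refine isComputableMap_of_approx hQ computable_μ (partrec_V.comp
    (g := fun p => (([], C.depth (p.2 + 1)), (p.1, p.2 + 1 + c))) (by fun_prop)) fun l k hl => ?_
  obtain ⟨v, mem_V, dist_le⟩ := eval k l (k + 1 + c) hl
  exact ⟨v, mem_V, fun x hx => (dist_le x hx).trans_lt (error_lt k)⟩

end Evaluation

/-! ### From algorithms to realisers -/

section Collapse

/-- Replace the `n` entries from position `i` on by the single entry `v`, which corresponds to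
`plug` in terms of lists of indices. -/
def collapse {α : Type*} (l : List α) (i n : ℕ) (v : α) : List α :=
  l.take i ++ v :: l.drop (i + n)

@[fun_prop]
theorem computable_collapse {α β : Type*} [Primcodable α] [Primcodable β] {f : α → List β}
    {i n : α → ℕ} {v : α → β} (hf : Computable f) (hi : Computable i) (hn : Computable n)
    (hv : Computable v) : Computable fun a => collapse (f a) (i a) (n a) (v a) := by
  unfold collapse
  fun_prop

theorem length_collapse {α : Type*} {l : List α} {i n m : ℕ} {v : α} (hl : l.length = n + m - 1)
    (hn : 0 < n) (hi : i < m) : (collapse l i n v).length = m := by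
  simp only [collapse, List.length_append, List.length_take, List.length_cons, List.length_drop]
  lia

theorem getD_collapse {α : Type*} {l : List α} {i n : ℕ} {v : α} (hi : i ≤ l.length) (j : ℕ)
    (a : α) : (collapse l i n v).getD j a =
      if j < i then l.getD j a else if j = i then v else l.getD (j + n - 1) a := by
  simp only [collapse, List.getD_eq_getElem?_getD, List.getElem?_append, List.length_take,
    min_eq_left hi]
  rcases lt_trichotomy j i with lt | rfl | gt
  · simp [lt]
  · simp
  · obtain ⟨t, rfl⟩ : ∃ t, j = i + t + 1 := ⟨j - (i + 1), by lia⟩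
    have sub_eq : i + t + 1 - i = t + 1 := by lia
    have add_eq : i + t + 1 + n - 1 = i + n + t := by lia
    simp [gt.not_gt, gt.ne', sub_eq, add_eq]

theorem dist_plug_collapse_lt {X : Type*} [MetricSpace X] {Q : ℕ → X} {n m : ℕ}
    (φ : (Fin n → X) → X) (i : Fin m) {l : List ℕ} (hl : (i : ℕ) ≤ l.length) {v : ℕ} {r : ℝ}
    (hr : 0 < r) (hv : dist (φ (tuple Q ((l.drop i).take n) n)) (Q v) < r) (j : Fin m) :
    dist (plug φ i (tuple Q l (n + m - 1)) j) (tuple Q (collapse l i n v) m j) < r := by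
  unfold plug
  simp only [tuple, getD_collapse hl]
  split_ifs
  · rwa [dist_self]
  · convert hv using 4 with k
    simp [tuple, List.getD_eq_getElem?_getD]
  · rwa [dist_self]

end Collapse

section Nodes

variable {X : Type*} [MetricSpace X] {Y : Type*} [MetricSpace Y]
  {D : ExtendedIFS X} {E : ExtendedIFS Y} {QX : ℕ → X} {QY : ℕ → Y}

/-- A step on the way from the root to a node: `Sum.inl (i, d, j)` means reading the argument `i`
with the digit `d` after `j` writing nodes, and `Sum.inr (e, κ)` means passing to the component `κ`
below a writing node labelled `e`. -/
abbrev Step (D : ExtendedIFS X) (E : ExtendedIFS Y) := (ℕ × Fin D.size × ℕ) ⊕ (Fin E.size × ℕ)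

/-- The state at a node: the steps leading to the node, the latest first, then for each argument of
the map at the node how often it has been read, and the number of writing nodes passed. -/
abbrev State (D : ExtendedIFS X) (E : ExtendedIFS Y) := List (Step D E) × List ℕ × ℕ

namespace State

/-- The steps leading to the node. -/
abbrev history (σ : State D E) : List (Step D E) := σ.1

/-- How often the arguments have been read. -/
abbrev reads (σ : State D E) : List ℕ := σ.2.1

/-- The number of writing nodes passed. -/
abbrev writes (σ : State D E) : ℕ := σ.2.2

end State

/-- A modulus of continuity after `j` writing nodes, if `ζ` is one at the root. -/
def modulusAfter (I : EffectiveInversion E QY) (ζ : ℕ → ℕ) (j k : ℕ) : ℕ := ζ (I.om^[j] k)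

/-- To evaluate the map at a node for the indices `a.1` with precision `a.2`, the map at the
previous node is evaluated for the indices and with the precision given here. -/
def previousArgs (C : EffectiveContraction D QX) (I : EffectiveInversion E QY) (ζ : ℕ → ℕ) :
    Step D E → List ℕ × ℕ → List ℕ × ℕ
  | .inl (i, d, j), (l, k) =>
    (collapse l i (D.ar d)
      (C.approx d ((l.drop i).take (D.ar d), modulusAfter I ζ j (k + 1))), k + 1)
  | .inr _, (l, k) => (l, I.om (k + 1))

/-- The value at a node from the value `v` at the previous node. -/
def nextValue (I : EffectiveInversion E QY) : Step D E → List ℕ × ℕ → ℕ → ℕ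
  | .inl _, _, v => v
  | .inr (e, κ), (_, k), v => (I.choice e (I.om (k + 1), v)).getD κ 0

/-- Approximations at basic points of the map belonging to a node, where `G` approximates the map
at the root. -/
def evalNode (C : EffectiveContraction D QX) (I : EffectiveInversion E QY) (ζ : ℕ → ℕ)
    (G : List ℕ × ℕ → ℕ) : List (Step D E) → List ℕ × ℕ → ℕ
  | [], a => G a
  | b :: h, a => nextValue I b a (evalNode C I ζ G h (previousArgs C I ζ b a))

/-- How often the arguments are to be read before the next writing node, if `j` writing nodes have
been passed. -/
def readDepth (C : EffectiveContraction D QX) (I : EffectiveInversion E QY) (ζ : ℕ → ℕ) (j : ℕ) :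
    ℕ := C.depth (modulusAfter I ζ j (I.leb + 3))

/-- The first argument that has not been read often enough. -/
def nextRead (C : EffectiveContraction D QX) (I : EffectiveInversion E QY) (ζ : ℕ → ℕ)
    (σ : State D E) : ℕ := σ.reads.findIdx fun a => a < readDepth C I ζ σ.writes

/-- An index of a basic point that is close to all values of the map at a node where all arguments
have been read often enough. -/
def baseValue (C : EffectiveContraction D QX) (I : EffectiveInversion E QY) (ζ : ℕ → ℕ)
    (G : List ℕ × ℕ → ℕ) (σ : State D E) : ℕ :=
  evalNode C I ζ G σ.history (List.replicate σ.reads.length 0, I.leb + 3)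

/-- The label of a node: read an argument that has not been read often enough; if there is none,
write a digit whose range contains the values of the map. -/
def nodeLabel (C : EffectiveContraction D QX) (I : EffectiveInversion E QY) (ζ : ℕ → ℕ)
    (G : List ℕ × ℕ → ℕ) (σ : State D E) : Label E :=
  if nextRead C I ζ σ < σ.reads.length then .inr (nextRead C I ζ σ)
  else .inl (I.sel (baseValue C I ζ G σ))

/-- The state after reading the argument `i` with the digit `d`. -/
def readChild (σ : State D E) (i : ℕ) (d : Fin D.size) : State D E :=
  (.inl (i, d, σ.writes) :: σ.history,
    plugList σ.reads i (List.replicate (D.ar d) (σ.reads.getD i 0 + 1)), σ.writes)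

/-- The state at the component `κ` after writing `e`. -/
def writeChild (σ : State D E) (e : Fin E.size) (κ : ℕ) : State D E :=
  (.inr (e, κ) :: σ.history, σ.reads, σ.writes + 1)

/-- The immediate successors of a node. -/
def nodeChild (C : EffectiveContraction D QX) (I : EffectiveInversion E QY) (ζ : ℕ → ℕ)
    (G : List ℕ × ℕ → ℕ) (σ : State D E) (c : ℕ) : State D E :=
  Sum.elim (fun e => writeChild σ e c)
    (fun i => (decode c : Option (Fin D.size)).elim σ (readChild σ i)) (nodeLabel C I ζ G σ)

variable {C : EffectiveContraction D QX} {I : EffectiveInversion E QY} {ζ : ℕ → ℕ}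
  {G : List ℕ × ℕ → ℕ}

theorem computable_ar {X : Type*} [TopologicalSpace X] (D : ExtendedIFS X) : Computable D.ar :=
  (Primrec.dom_finite D.ar).to_comp

theorem computable_modulusAfter (hζ : Computable ζ) :
    Computable fun p : ℕ × ℕ => modulusAfter I ζ p.1 p.2 := by
  have computable_om := I.computable_om
  have computable_iterate : Computable fun p : ℕ × ℕ => I.om^[p.1] p.2 :=
    (Computable.nat_rec (h := fun _ s => I.om s.2) Computable.fst Computable.snd
      (by unfold Computable₂; fun_prop)).of_eq fun p => by
        induction p.1 with
        | zero => rfl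
        | succ j ih => exact (congrArg I.om ih).trans (Function.iterate_succ_apply' ..).symm
  exact hζ.comp computable_iterate

theorem computable_previousArgs (hζ : Computable ζ) :
    Computable fun p : Step D E × List ℕ × ℕ => previousArgs C I ζ p.1 p.2 := by
  have computable_ar := computable_ar D
  have computable_approx := C.computable_approx
  have computable_om := I.computable_om
  have computable_modulusAfter := computable_modulusAfter (I := I) hζ
  refine (computable_sumElim (f := fun p : Step D E × List ℕ × ℕ => p.1)
    (g := fun p b => (collapse p.2.1 b.1 (D.ar b.2.1) (C.approx b.2.1
      ((p.2.1.drop b.1).take (D.ar b.2.1), modulusAfter I ζ b.2.2 (p.2.2 + 1))), p.2.2 + 1))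
    (h := fun p _ => (p.2.1, I.om (p.2.2 + 1)))
    (by fun_prop) (by fun_prop) (by fun_prop)).of_eq ?_
  rintro ⟨_ | _, _⟩ <;> rfl

theorem computable_nextValue :
    Computable fun p : Step D E × (List ℕ × ℕ) × ℕ => nextValue I p.1 p.2.1 p.2.2 := by
  have computable_om := I.computable_om
  have computable_choice := I.computable_choice
  refine (computable_sumElim (f := fun p : Step D E × (List ℕ × ℕ) × ℕ => p.1)
    (g := fun p _ => p.2.2)
    (h := fun p b => (I.choice b.1 (I.om (p.2.1.2 + 1), p.2.2)).getD b.2 0)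
    (by fun_prop) (by fun_prop) (by fun_prop)).of_eq ?_
  rintro ⟨_ | _, _⟩ <;> rfl

theorem computable_evalNode (hζ : Computable ζ) (hG : Computable G) :
    Computable fun p : List (Step D E) × List ℕ × ℕ => evalNode C I ζ G p.1 p.2 :=
  computable_list_rec_param hG (computable_previousArgs hζ) computable_nextValue
    (fun _ => rfl) fun _ _ _ => rfl

theorem computable_nextRead (hζ : Computable ζ) :
    Computable fun σ : State D E => nextRead C I ζ σ := by
  have computable_depth := C.computable_depth
  have computable_modulusAfter := computable_modulusAfter (I := I) hζ
  have computable_findIdx : Computable fun p : List ℕ × ℕ => p.1.findIdx fun a => a < p.2 :=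
    (Primrec.list_findIdx Primrec.fst (Primrec.nat_lt.decide.comp Primrec.snd
      (Primrec.snd.comp Primrec.fst)).to₂).to_comp
  exact computable_findIdx.comp
    (g := fun σ : State D E => (σ.reads, readDepth C I ζ σ.writes))
    (by unfold readDepth; fun_prop)

theorem computable_nodeLabel (hζ : Computable ζ) (hG : Computable G) :
    Computable fun σ : State D E => nodeLabel C I ζ G σ := by
  have computable_nextRead := computable_nextRead (D := D) (C := C) (I := I) hζ
  have computable_evalNode := computable_evalNode (C := C) (I := I) hζ hG
  have computable_sel := I.computable_sel
  exact computable_ite_lt (by fun_prop) (by fun_prop) (Computable.sumInr.comp computable_nextRead)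
    (Computable.sumInl.comp (by unfold baseValue; fun_prop))

theorem computable_readChild :
    Computable fun p : State D E × ℕ × Fin D.size => readChild p.1 p.2.1 p.2.2 := by
  have computable_ar := computable_ar D
  have computable_step : Computable fun p : State D E × ℕ × Fin D.size =>
      (.inl (p.2.1, p.2.2, p.1.writes) : Step D E) := Computable.sumInl.comp (by fun_prop)
  unfold readChild
  fun_prop

theorem computable_writeChild :
    Computable fun p : State D E × Fin E.size × ℕ => writeChild p.1 p.2.1 p.2.2 := by
  have computable_step : Computable fun p : State D E × Fin E.size × ℕ =>
      (.inr (p.2.1, p.2.2) : Step D E) := Computable.sumInr.comp (by fun_prop)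
  unfold writeChild
  fun_prop

theorem computable_nodeChild (hζ : Computable ζ) (hG : Computable G) :
    Computable fun p : State D E × ℕ => nodeChild C I ζ G p.1 p.2 := by
  have computable_nodeLabel := computable_nodeLabel (C := C) (I := I) hζ hG
  have computable_readChild := computable_readChild (D := D) (E := E)
  have computable_writeChild := computable_writeChild (D := D) (E := E)
  have computable_decode : Computable (decode : ℕ → Option (Fin D.size)) := Computable.decode
  unfold nodeChild
  fun_prop

end Nodes

section Termination

/-- The weight of an argument that has been read `a` times and is to be read `N` times, if digits
have at most `A` arguments. -/
def readWeight (A N a : ℕ) : ℕ := if a < N then (A + 1) ^ (N - a) else 0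

theorem mul_readWeight_succ_lt {A N a n : ℕ} (hn : n ≤ A) (ha : a < N) :
    n * readWeight A N (a + 1) < readWeight A N a := by
  have le_pow : readWeight A N (a + 1) ≤ (A + 1) ^ (N - (a + 1)) := by
    unfold readWeight
    split_ifs
    exacts [le_rfl, Nat.zero_le _]
  calc n * readWeight A N (a + 1) ≤ A * (A + 1) ^ (N - (a + 1)) := Nat.mul_le_mul hn le_pow
    _ < (A + 1) * (A + 1) ^ (N - (a + 1)) := by gcongr; exact A.lt_succ_self
    _ = readWeight A N a := by
      rw [readWeight, if_pos ha, ← pow_succ']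
      congr 1
      lia

theorem sum_readWeight_plugList_lt {A N n i : ℕ} {l : List ℕ} (hn : n ≤ A) (hi : i < l.length)
    (hlt : l.getD i 0 < N) :
    ((plugList l i (List.replicate n (l.getD i 0 + 1))).map (readWeight A N)).sum <
      (l.map (readWeight A N)).sum := by
  have split_at : l = l.take i ++ l.getD i 0 :: l.drop (i + 1) := by
    rw [List.getD_eq_getElem _ _ hi, ← List.drop_eq_getElem_cons hi, List.take_append_drop]
  conv_rhs => rw [split_at]
  simp only [plugList, List.map_append, List.map_cons, List.sum_append, List.sum_cons,
    List.map_replicate, List.sum_replicate, smul_eq_mul]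
  linarith [mul_readWeight_succ_lt hn hlt]

variable {X : Type*} [MetricSpace X] {Y : Type*} [MetricSpace Y]
  {D : ExtendedIFS X} {E : ExtendedIFS Y} {QX : ℕ → X} {QY : ℕ → Y}
  {C : EffectiveContraction D QX} {I : EffectiveInversion E QY} {ζ : ℕ → ℕ} {σ : State D E}

/-- A natural number that decreases with every reading step; it bounds the number of reading nodes
that can follow before the next writing node. -/
def readRank (C : EffectiveContraction D QX) (I : EffectiveInversion E QY) (ζ : ℕ → ℕ)
    (σ : State D E) : ℕ :=
  (σ.reads.map (readWeight (Finset.univ.sup D.ar) (readDepth C I ζ σ.writes))).sum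

theorem getD_nextRead_lt (h : nextRead C I ζ σ < σ.reads.length) :
    σ.reads.getD (nextRead C I ζ σ) 0 < readDepth C I ζ σ.writes := by
  rw [List.getD_eq_getElem _ _ h]
  exact of_decide_eq_true (List.findIdx_getElem (w := h))

theorem readDepth_le_getD_reads (h : ¬ nextRead C I ζ σ < σ.reads.length) {j : ℕ}
    (hj : j < σ.reads.length) : readDepth C I ζ σ.writes ≤ σ.reads.getD j 0 := by
  contrapose! h
  rw [List.getD_eq_getElem _ _ hj] at h
  exact List.findIdx_lt_length_of_exists ⟨_, List.getElem_mem hj, decide_eq_true h⟩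

theorem readRank_readChild_lt (h : nextRead C I ζ σ < σ.reads.length) (d : Fin D.size) :
    readRank C I ζ (readChild σ (nextRead C I ζ σ) d) < readRank C I ζ σ :=
  sum_readWeight_plugList_lt (Finset.le_sup (Finset.mem_univ d)) h (getD_nextRead_lt h)

end Termination

section Completeness

variable {X : Type*} [MetricSpace X] {Y : Type*} [MetricSpace Y]
  {D : ExtendedIFS X} {E : ExtendedIFS Y} {QX : ℕ → X} {QY : ℕ → Y}

/-- The map `f` belongs to the state `σ`: there is a modulus of continuity in which an argument
that has been read `a` times counts with the factor `C.K ^ a`, and `evalNode` approximates `f`. -/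
structure BelongsTo (C : EffectiveContraction D QX) (I : EffectiveInversion E QY) (ζ : ℕ → ℕ)
    (G : List ℕ × ℕ → ℕ) (σ : State D E) (f : Maps X Y) : Prop where
  length_reads : σ.reads.length = f.1
  dist_lt : ∀ k x x', (∀ j : Fin f.1, C.K ^ σ.reads.getD j 0 * dist (x j) (x' j) <
    (1 / 2 : ℝ) ^ modulusAfter I ζ σ.writes k) → dist (f.2 x) (f.2 x') < (1 / 2 : ℝ) ^ k
  dist_evalNode_lt : ∀ l k, l.length = f.1 →
    dist (f.2 (tuple QX l f.1)) (QY (evalNode C I ζ G σ.history (l, k))) < (1 / 2 : ℝ) ^ k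

theorem mul_dist_pi_lt {n : ℕ} {c r : ℝ} (hc : 0 ≤ c) (hr : 0 < r) {y y' : Fin n → X}
    (h : ∀ j, c * dist (y j) (y' j) < r) : c * dist y y' < r := by
  rcases hc.eq_or_lt with rfl | hc
  · rwa [zero_mul]
  · simp only [← lt_div_iff₀' hc] at h ⊢
    exact (dist_pi_lt_iff (div_pos hr hc)).2 h

theorem EffectiveContraction.pow_mul_dist_plug_lt (C : EffectiveContraction D QX) {m : ℕ}
    {i : Fin m} {d : Fin D.size} {l : List ℕ} {r : ℝ} (hr : 0 < r) (hl : l.length = m)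
    {x x' : Fin (D.ar d + m - 1) → X}
    (h : ∀ j : Fin (D.ar d + m - 1), C.K ^ (plugList l i
      (List.replicate (D.ar d) (l.getD i 0 + 1))).getD j 0 * dist (x j) (x' j) < r) (j : Fin m) :
    C.K ^ l.getD j 0 * dist (plug (D.digit d) i x j) (plug (D.digit d) i x' j) < r := by
  simp only [getD_plugList (show (i : ℕ) < l.length by rw [hl]; exact i.2),
    List.length_replicate] at h
  rcases lt_trichotomy (j : ℕ) i with lt | eq | gt
  · simpa [plug, lt] using h ⟨j, by lia⟩
  · obtain rfl : j = i := Fin.ext eq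
    simp only [plug, lt_irrefl, dite_false, dite_true]
    have weighted : C.K ^ (l.getD j 0 + 1) * dist (fun k : Fin (D.ar d) => x ⟨j + k, by lia⟩)
        (fun k => x' ⟨j + k, by lia⟩) < r :=
      mul_dist_pi_lt (pow_nonneg C.K_nonneg _) hr fun k => by
        simpa [List.getD_eq_getElem?_getD] using h ⟨j + k, by lia⟩
    rw [pow_succ, mul_assoc] at weighted
    exact (mul_le_mul_of_nonneg_left (C.dist_digit_le d _ _)
      (pow_nonneg C.K_nonneg _)).trans_lt weighted
  · have pos := D.ar_pos d
    have not_lt : ¬ (j : ℕ) + D.ar d - 1 < i := by lia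
    have not_lt_add : ¬ (j : ℕ) + D.ar d - 1 < i + D.ar d := by lia
    have shift_back : (j : ℕ) + D.ar d - 1 + 1 - D.ar d = j := by lia
    simpa [plug, gt.not_gt, gt.ne', not_lt, not_lt_add, shift_back]
      using h ⟨j + D.ar d - 1, by lia⟩

namespace BelongsTo

variable {C : EffectiveContraction D QX} {I : EffectiveInversion E QY} {ζ : ℕ → ℕ}
  {G : List ℕ × ℕ → ℕ} {σ : State D E} {f : Maps X Y}

theorem root
    (hζ : ∀ k x x', dist x x' < (1 / 2 : ℝ) ^ ζ k → dist (f.2 x) (f.2 x') < (1 / 2 : ℝ) ^ k)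
    (hG : ∀ l k, dist (f.2 (tuple QX l f.1)) (QY (G (l, k))) < (1 / 2 : ℝ) ^ k) :
    BelongsTo C I ζ G (([], List.replicate f.1 0, 0) : State D E) f where
  length_reads := List.length_replicate
  dist_lt k x x' hx := hζ k x x' <| (dist_pi_lt_iff (by positivity)).2 fun j => by
    simpa [State.reads, State.writes, modulusAfter, List.getD_eq_getElem?_getD] using hx j
  dist_evalNode_lt l k _ := hG l k

theorem readChild (h : BelongsTo C I ζ G σ f) (i : Fin f.1) (d : Fin D.size) :
    BelongsTo C I ζ G (readChild σ i d) ⟨D.ar d + f.1 - 1, f.2 ∘ plug (D.digit d) i⟩ where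
  length_reads := by
    rw [DigitSpaces.readChild, length_plugList (by rw [h.length_reads]; exact i.2),
      List.length_replicate, h.length_reads]
  dist_lt k x x' hx := h.dist_lt k _ _
    (C.pow_mul_dist_plug_lt (by positivity) h.length_reads hx)
  dist_evalNode_lt l k hl := by
    dsimp only at hl
    set v := C.approx d ((l.drop i).take (D.ar d), modulusAfter I ζ σ.writes (k + 1))
    have dist_collapse : dist (f.2 (plug (D.digit d) i (tuple QX l (D.ar d + f.1 - 1))))
        (f.2 (tuple QX (collapse l i (D.ar d) v) f.1)) < (1 / 2 : ℝ) ^ (k + 1) := by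
      refine h.dist_lt (k + 1) _ _ fun j => ?_
      refine (mul_le_of_le_one_left dist_nonneg
        (pow_le_one₀ C.K_nonneg C.K_lt_one.le)).trans_lt ?_
      exact dist_plug_collapse_lt (D.digit d) i (by lia) (by positivity)
        (C.dist_approx_lt d _ _) j
    have dist_previous := h.dist_evalNode_lt (collapse l i (D.ar d) v) (k + 1)
      (length_collapse hl (D.ar_pos d) i.2)
    rw [half_pow_succ] at dist_collapse dist_previous
    exact (dist_triangle _ (f.2 (tuple QX (collapse l i (D.ar d) v) f.1)) _).trans_lt
      ((add_lt_add dist_collapse dist_previous).trans_eq (add_halves _))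

theorem writeChild (h : BelongsTo C I ζ G σ f) {v : ℕ}
    (hv : ∀ x, dist (f.2 x) (QY v) < (1 / 2 : ℝ) ^ (I.leb + 2)) (κ : Fin (E.ar (I.sel v))) :
    BelongsTo C I ζ G (writeChild σ (I.sel v) κ) ⟨f.1, fun x => I.sec (I.sel v) (f.2 x) κ⟩ where
  length_reads := h.length_reads
  dist_lt k x x' hx := by
    have mem_interior (x) : f.2 x ∈ interior (Set.range (E.digit (I.sel v))) :=
      ball_subset_interior (I.ball_sel_subset v) ((hv x).trans_le (half_pow_anti (by lia)))
    exact (dist_le_pi_dist _ _ κ).trans_lt <| I.dist_sec_lt _ k _ _ (mem_interior x)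
      (mem_interior x') (h.dist_lt (I.om k) x x' hx)
  dist_evalNode_lt l k hl := by
    set w := evalNode C I ζ G σ.history (l, I.om (k + 1))
    have dist_w : dist (f.2 (tuple QX l f.1)) (QY w) < (1 / 2 : ℝ) ^ I.om (k + 1) :=
      h.dist_evalNode_lt l _ hl
    have dist_w_v : dist (QY w) (QY v) < (1 / 2 : ℝ) ^ (I.leb + 1) := by
      have dist_w_le := dist_w.trans_le (half_pow_anti (I.leb_add_two_le_om (k + 1)))
      linarith [hv (tuple QX l f.1), half_pow_succ (I.leb + 1),
        dist_triangle_left (QY w) (QY v) (f.2 (tuple QX l f.1))]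
    have ball_subset : Metric.ball (QY w) ((1 / 2 : ℝ) ^ (I.leb + 1)) ⊆
        Set.range (E.digit (I.sel v)) :=
      (Metric.ball_subset_ball' (by linarith [half_pow_succ I.leb])).trans (I.ball_sel_subset v)
    exact (dist_le_pi_dist _ _ κ).trans_lt
      (I.dist_sec_choice_lt_of_dist_lt le_rfl ball_subset dist_w)

theorem dist_baseValue_lt (h : BelongsTo C I ζ G σ f)
    (hreads : ∀ j : Fin f.1, readDepth C I ζ σ.writes ≤ σ.reads.getD j 0) (x : Fin f.1 → X) :
    dist (f.2 x) (QY (baseValue C I ζ G σ)) < (1 / 2 : ℝ) ^ (I.leb + 2) := by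
  set b := tuple QX (List.replicate σ.reads.length 0) f.1
  have dist_base : dist (f.2 x) (f.2 b) < (1 / 2 : ℝ) ^ (I.leb + 3) :=
    h.dist_lt _ _ _ fun j => (mul_le_mul_of_nonneg_left (C.dist_le _ _)
      (pow_nonneg C.K_nonneg _)).trans_lt (C.pow_mul_lt _ _ (hreads j))
  have dist_eval : dist (f.2 b) (QY (baseValue C I ζ G σ)) < (1 / 2 : ℝ) ^ (I.leb + 3) :=
    h.dist_evalNode_lt _ _ (by rw [List.length_replicate, h.length_reads])
  linarith [dist_triangle (f.2 x) (f.2 b) (QY (baseValue C I ζ G σ)), half_pow_succ (I.leb + 2)]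

theorem isStep (h : BelongsTo C I ζ G σ f) :
    IsStep D E (nodeLabel C I ζ G σ) (fun k => BelongsTo C I ζ G (nodeChild C I ζ G σ k))
      (fun k g => readRank C I ζ (nodeChild C I ζ G σ k) < readRank C I ζ σ ∧
        BelongsTo C I ζ G (nodeChild C I ζ G σ k) g) f := by
  unfold nodeChild
  by_cases lt_length : nextRead C I ζ σ < σ.reads.length
  · have lt_arity : nextRead C I ζ σ < f.1 := h.length_reads ▸ lt_length
    have label_eq : nodeLabel C I ζ G σ = .inr (nextRead C I ζ σ) := if_pos lt_length
    rw [label_eq]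
    refine .inr ⟨⟨_, lt_arity⟩, rfl, fun d => ?_⟩
    have decode_eq : (decode (d : ℕ) : Option (Fin D.size)) = some d := encodek d
    simp only [Sum.elim_inr, decode_eq, Option.elim_some]
    exact ⟨readRank_readChild_lt lt_length d, h.readChild ⟨_, lt_arity⟩ d⟩
  · have label_eq : nodeLabel C I ζ G σ = .inl (I.sel (baseValue C I ζ G σ)) := if_neg lt_length
    have dist_lt := h.dist_baseValue_lt fun j =>
      readDepth_le_getD_reads lt_length (by rw [h.length_reads]; exact j.2)
    rw [label_eq]
    refine .inl ⟨_, rfl, fun κ x => I.sec _ (f.2 x) κ, h.writeChild dist_lt, funext fun x => ?_⟩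
    exact (I.digit_sec _ _ (ball_subset_interior (I.ball_sel_subset _)
      ((dist_lt x).trans_le (half_pow_anti (by lia))))).symm

end BelongsTo

theorem exists_isComputable_realises (C : EffectiveContraction D QX) (I : EffectiveInversion E QY)
    {f : Maps X Y} (hf : IsComputableMap QX QY f.2) :
    ∃ T : FTree D E, T.IsComputable ∧ Realises D E T f := by
  obtain ⟨ζ, hζ, hζ'⟩ := hf.exists_modulus
  obtain ⟨G, hG, hG'⟩ := hf.exists_approx
  exact ⟨_, LTree.isComputable_unfold
    (computable_sumElim .id ((computable_ar E).comp .snd) (.const D.size))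
    (computable_nodeLabel hζ hG) (computable_nodeChild hζ hG) _,
    realises_unfold (I := BelongsTo C I ζ G) (fun _ _ => BelongsTo.isStep) (.root hζ' hG')⟩

end Completeness

end DigitSpaces

theorem mainTheorem5_general {X Y : Type*} [MetricSpace X] [MetricSpace Y]
    (D : DigitSpaces.ExtendedIFS X) (QX : ℕ → X)
    (E : DigitSpaces.ExtendedIFS Y) (QY : ℕ → Y)
    (hX : DigitSpaces.IsDigitSpace D) (hQX : DenseRange QX)
    (hXcomp : ∀ d, DigitSpaces.IsComputableMap QX QX (D.digit d))
    (hXdec : DigitSpaces.IsDecidable D QX) (hXwc : DigitSpaces.IsWellCovering D)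
    (hXac : DigitSpaces.HasApproximableChoice D QX)
    (hY : DigitSpaces.IsDigitSpace E) (hQY : DenseRange QY)
    (hYcomp : ∀ e, DigitSpaces.IsComputableMap QY QY (E.digit e))
    (hYdec : DigitSpaces.IsDecidable E QY) (hYwc : DigitSpaces.IsWellCovering E)
    (hYac : DigitSpaces.HasApproximableChoice E QY) :
    DigitSpaces.CF D E = {f | ∃ T : DigitSpaces.FTree D E, DigitSpaces.Realises D E T f} ∧
    {f : DigitSpaces.Maps X Y |
        ∃ T : DigitSpaces.FTree D E, T.IsComputable ∧ DigitSpaces.Realises D E T f} =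
      {f : DigitSpaces.Maps X Y | DigitSpaces.IsComputableMap QX QY f.2} := by
  have := hX.compact
  have := hY.compact
  obtain ⟨CX⟩ := DigitSpaces.nonempty_effectiveContraction hX hXcomp
  obtain ⟨CY⟩ := DigitSpaces.nonempty_effectiveContraction hY hYcomp
  obtain ⟨IX⟩ := DigitSpaces.nonempty_effectiveInversion hQX hXdec hXwc hXac
  obtain ⟨IY⟩ := DigitSpaces.nonempty_effectiveInversion hQY hYdec hYwc hYac
  exact ⟨Set.ext fun _ => DigitSpaces.mem_CF_iff_exists_realises, Set.ext fun _ =>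
    ⟨fun ⟨_, hT, h⟩ => DigitSpaces.isComputableMap_of_realises IX CY hQX hT h,
      DigitSpaces.exists_isComputable_realises CX IY⟩⟩

theorem mainTheorem5 {X Y : Type*} [MetricSpace X] [MetricSpace Y]
    (D : DigitSpaces.ExtendedIFS X) (QX : ℕ → X)
    (E : DigitSpaces.ExtendedIFS Y) (QY : ℕ → Y)
    (hX : DigitSpaces.IsComputableDigitSpace D QX)
    (hXdec : DigitSpaces.IsDecidable D QX)
    (hXwc : DigitSpaces.IsWellCovering D)
    (hXac : DigitSpaces.HasApproximableChoice D QX)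
    (hY : DigitSpaces.IsComputableDigitSpace E QY)
    (hYdec : DigitSpaces.IsDecidable E QY)
    (hYwc : DigitSpaces.IsWellCovering E)
    (hYac : DigitSpaces.HasApproximableChoice E QY) :
    DigitSpaces.CF D E = {f | ∃ T : DigitSpaces.FTree D E, DigitSpaces.Realises D E T f} ∧
    {f : DigitSpaces.Maps X Y |
        ∃ T : DigitSpaces.FTree D E, T.IsComputable ∧ DigitSpaces.Realises D E T f} =
      {f : DigitSpaces.Maps X Y | DigitSpaces.IsComputableMap QX QY f.2} :=
  mainTheorem5_general D QX E QY hX.digitSpace hX.computableMetric.dense hX.computable_digit hXdec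
    hXwc hXac hY.digitSpace hY.computableMetric.dense hY.computable_digit hYdec hYwc hYac
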